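/- Fix $\gamma\in\mathbb R$. A state consists of real numbers $\Sigma_+,\Sigma_-,\Sigma_{12},\Sigma_{13},\Sigma_{23},N,\bar N,\Omega$ and $v=(v_1,v_2,v_3)$; put $$\Sigma_{ab}=\begin{bmatrix}-2\Sigma_+&\sqrt3\Sigma_{12}&\sqrt3\Sigma_{13}\\ \sqrt3\Sigma_{12}&\Sigma_++\sqrt3\Sigma_-&\sqrt3\Sigma_{23}\\ \sqrt3\Sigma_{13}&\sqrt3\Sigma_{23}&\Sigma_+-\sqrt3\Sigma_-\end{bmatrix},$$ $\Sigma^2=\Sigma_+^2+\Sigma_-^2+\Sigma_{12}^2+\Sigma_{13}^2+\Sigma_{23}^2$, $V=|v|$, $v=Vc$ with $|c|=1$ (any $c$ may be taken if $V=0$), $\mathcal S=\sum_{a,b}\Sigma_{ab}c_ac_b$, $G=1+(\gamma-1)V^2$ and $q=2\Sigma^2+\frac{(3\gamma-2)+(2-\gamma)V^2}{2G}\,\Omega$. The state space $T(VI_0)$ (boundaries included) is the set of states with $\Omega\ge0$, $\bar N^2\le N^2$, $V\le1$ and $$\begin{aligned}1&=\Sigma^2+N^2+\Omega,& 0&=2\Sigma_-NG+\gamma\Omega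 v_1,\\ 0&=-(\Sigma_{12}N+\Sigma_{13}\bar N)G+\gamma\Omega v_2,& 0&=(\Sigma_{13}N+\Sigma_{12}\bar N)G+\gamma\Omega v_3.\end{aligned}$$ A solution curve is a curve $\tau\mapsto X(\tau)\in T(VI_0)$, $\tau\ge0$, satisfying the tilted Bianchi VI$_0$ equations (prime $=d/d\tau$, one-sided at $\tau=0$), where $R_1$ is subject to $NR_1=\sqrt3\Sigma_-\bar N$: $$\begin{aligned} \Sigma_+'&=(q-2)\Sigma_++3(\Sigma_{12}^2+\Sigma_{13}^2)-2N^2+\tfrac12\left[4N\Sigma_-v_1+(N\Sigma_{12}+\bar N\Sigma_{13})v_2-(N\Sigma_{13}+\bar N\Sigma_{12})v_3\right],\\ \Sigma_-'&=(q-2)\Sigma_-+\sqrt3(\Sigma_{12}^2-\Sigma_{13}^2)-2R_1\Sigma_{23}+\tfrac{\sqrt3}2\left[(N\Sigma_{12}+\bar N\Sigma_{13})v_2+(N\Sigma_{13}+\bar N\Sigma_{12})v_3\right],\\ \Sigma_{12}'&=(q-2-3\Sigma_+-\sqrt3\Sigma_-+\sqrt3Nv_1)\Sigma_{12}-(R_1+\sqrt3\Sigma_{23}-\sqrt3\bar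 Nv_1)\Sigma_{13},\\ \Sigma_{13}'&=(q-2-3\Sigma_++\sqrt3\Sigma_--\sqrt3Nv_1)\Sigma_{13}-(-R_1+\sqrt3\Sigma_{23}+\sqrt3\bar Nv_1)\Sigma_{12},\\ \Sigma_{23}'&=(q-2)\Sigma_{23}-2\sqrt3\bar NN+2R_1\Sigma_-+2\sqrt3\Sigma_{12}\Sigma_{13}-\sqrt3v_2(N\Sigma_{13}+\bar N\Sigma_{12}),\\ N'&=(q+2\Sigma_+)N+2\sqrt3\Sigma_{23}\bar N,\qquad \bar N'=(q+2\Sigma_+)\bar N+2\sqrt3\Sigma_{23}N,\\ \Omega'&=\frac{\Omega}{G}\left\{2q-(3\gamma-2)+\left[2q(\gamma-1)-(2-\gamma)-\gamma\mathcal S\right]V^2\right\},\\ V'&=\frac{V(1-V^2)}{1-(\gamma-1)V^2}\left[(3\gamma-4)-\mathcal S\right]. \end{aligned}$$ Let $T_1(VI_0)$ be the subset of $T(VI_0)$ given by $\Sigma_{12}=\Sigma_{13}=0$. **Theorem (Global attractors for $T_1(VI_0)$).** Let $2/3<\gamma<4/3$ and let $p\in T_1(VI_0)$ satisfy $\Omega>0$,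 $N^2>\bar N^2$ and $V<1$. Then there is a solution curve on $[0,\infty)$ that starts at $p$, and every such curve converges as $\tau\to\infty$ to the Collins VI$_0$ equilibrium $\mathcal C(VI_0)$, i.e. $\omega(p)=\mathcal C(VI_0)$: $$\Sigma_-=\Sigma_{12}=\Sigma_{13}=\Sigma_{23}=\bar N=0,\quad v=0,\quad \Sigma_+=-\tfrac14(3\gamma-2),\quad N^2=\tfrac3{16}(3\gamma-2)(2-\gamma),\quad \Omega=\tfrac34(2-\gamma),$$ where $N$ has the same sign as at $p$. -/

import Mathlib

noncomputable section

namespace TiltedVI0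

/-- Expansion-normalised variables of a tilted Bianchi cosmology with structure constants
`N₂₂ = N₃₃ = √3 N̄`, `N₂₃ = N₃₂ = √3 N`: the shear components `Σ₊, Σ₋, Σ₁₂, Σ₁₃, Σ₂₃`, the
curvature variables `N, N̄`, the density parameter `Ω` and the fluid velocity `v = (v₁, v₂, v₃)`. -/
@[ext]
structure State where
  sigP : ℝ
  sigM : ℝ
  sig12 : ℝ
  sig13 : ℝ
  sig23 : ℝ
  N : ℝ
  Nbar : ℝ
  Ω : ℝ
  v1 : ℝ
  v2 : ℝ
  v3 : ℝ

namespace State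

/-- The coordinates of a state, as a vector in `ℝ¹¹`. -/
def coords (X : State) : Fin 11 → ℝ :=
  ![X.sigP, X.sigM, X.sig12, X.sig13, X.sig23, X.N, X.Nbar, X.Ω, X.v1, X.v2, X.v3]

/-- States carry the topology of `ℝ¹¹`. -/
instance : TopologicalSpace State := TopologicalSpace.induced coords inferInstance

/-- The expansion-normalised shear matrix `Σ_ab`. -/
def shearMatrix (X : State) : Matrix (Fin 3) (Fin 3) ℝ :=
  !![-2 * X.sigP, √3 * X.sig12, √3 * X.sig13;
     √3 * X.sig12, X.sigP + √3 * X.sigM, √3 * X.sig23;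
     √3 * X.sig13, √3 * X.sig23, X.sigP - √3 * X.sigM]

/-- The shear scalar `Σ²`. -/
def shearSq (X : State) : ℝ :=
  X.sigP ^ 2 + X.sigM ^ 2 + X.sig12 ^ 2 + X.sig13 ^ 2 + X.sig23 ^ 2

/-- The speed `V = |v|` of the fluid. -/
def V (X : State) : ℝ := √(X.v1 ^ 2 + X.v2 ^ 2 + X.v3 ^ 2)

/-- The direction `c = v / V` of the tilt. For `V = 0` the direction is irrelevant: it enters the
evolution equations only through products with `V`; the value here is then `0`. -/
def c (X : State) : Fin 3 → ℝ := fun a => ![X.v1, X.v2, X.v3] a / X.V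

/-- `𝒮 = Σ_ab cᵃ cᵇ`. -/
def S (X : State) : ℝ := ∑ a, ∑ b, X.shearMatrix a b * X.c a * X.c b

/-- The deceleration parameter `q`. -/
def q (γ : ℝ) (X : State) : ℝ :=
  2 * X.shearSq
    + 1 / 2 * (((3 * γ - 2) + (2 - γ) * X.V ^ 2) / (1 + (γ - 1) * X.V ^ 2)) * X.Ω

end State

open State

/-- The state space `T(VI₀)` of tilted type VI₀ models, boundaries included: the Hamiltonian
constraint, the three momentum constraints, and the bounds `Ω ≥ 0`, `N̄² ≤ N²`, `V ≤ 1`. -/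
structure InT (γ : ℝ) (X : State) : Prop where
  hamiltonian : 1 = X.shearSq + X.N ^ 2 + X.Ω
  momentum1 : 0 = 2 * X.sigM * X.N * (1 + (γ - 1) * X.V ^ 2) + γ * X.Ω * X.v1
  momentum2 : 0 = -(X.sig12 * X.N + X.sig13 * X.Nbar) * (1 + (γ - 1) * X.V ^ 2)
    + γ * X.Ω * X.v2
  momentum3 : 0 = (X.sig13 * X.N + X.sig12 * X.Nbar) * (1 + (γ - 1) * X.V ^ 2)
    + γ * X.Ω * X.v3
  density_nonneg : 0 ≤ X.Ω
  typeVI0 : X.Nbar ^ 2 ≤ X.N ^ 2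
  speed_le_one : X.V ≤ 1

/-- The invariant subspace `T₁(VI₀)` of one-component tilt: `Σ₁₂ = Σ₁₃ = 0`. -/
structure InT1 (γ : ℝ) (X : State) : Prop extends InT γ X where
  sig12_eq : X.sig12 = 0
  sig13_eq : X.sig13 = 0

/-! Right-hand sides of the evolution equations; `R` is the frame rotation `R₁`. -/

def dSigP (γ : ℝ) (X : State) : ℝ :=
  (X.q γ - 2) * X.sigP + 3 * (X.sig12 ^ 2 + X.sig13 ^ 2) - 2 * X.N ^ 2
    + 1 / 2 * (4 * X.N * X.sigM * X.v1 + (X.N * X.sig12 + X.Nbar * X.sig13) * X.v2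
      - (X.N * X.sig13 + X.Nbar * X.sig12) * X.v3)

def dSigM (γ R : ℝ) (X : State) : ℝ :=
  (X.q γ - 2) * X.sigM + √3 * (X.sig12 ^ 2 - X.sig13 ^ 2) - 2 * R * X.sig23
    + √3 / 2 * ((X.N * X.sig12 + X.Nbar * X.sig13) * X.v2
      + (X.N * X.sig13 + X.Nbar * X.sig12) * X.v3)

def dSig12 (γ R : ℝ) (X : State) : ℝ :=
  (X.q γ - 2 - 3 * X.sigP - √3 * X.sigM + √3 * X.N * X.v1) * X.sig12
    - (R + √3 * X.sig23 - √3 * X.Nbar * X.v1) * X.sig13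

def dSig13 (γ R : ℝ) (X : State) : ℝ :=
  (X.q γ - 2 - 3 * X.sigP + √3 * X.sigM - √3 * X.N * X.v1) * X.sig13
    - (-R + √3 * X.sig23 + √3 * X.Nbar * X.v1) * X.sig12

def dSig23 (γ R : ℝ) (X : State) : ℝ :=
  (X.q γ - 2) * X.sig23 - 2 * √3 * X.Nbar * X.N + 2 * R * X.sigM
    + 2 * √3 * X.sig12 * X.sig13 - √3 * X.v2 * (X.N * X.sig13 + X.Nbar * X.sig12)

def dN (γ : ℝ) (X : State) : ℝ :=
  (X.q γ + 2 * X.sigP) * X.N + 2 * √3 * X.sig23 * X.Nbar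

def dNbar (γ : ℝ) (X : State) : ℝ :=
  (X.q γ + 2 * X.sigP) * X.Nbar + 2 * √3 * X.sig23 * X.N

def dΩ (γ : ℝ) (X : State) : ℝ :=
  X.Ω / (1 + (γ - 1) * X.V ^ 2)
    * (2 * X.q γ - (3 * γ - 2) + (2 * X.q γ * (γ - 1) - (2 - γ) - γ * X.S) * X.V ^ 2)

def dV (γ : ℝ) (X : State) : ℝ :=
  X.V * (1 - X.V ^ 2) / (1 - (γ - 1) * X.V ^ 2) * ((3 * γ - 4) - X.S)

/-- `X` is a solution curve of the tilted type VI₀ system on `[0, ∞)`: it stays in the state space,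
and the evolution equations hold for a frame rotation `R = R₁` that satisfies
`N R₁ = √3 Σ₋ N̄`. Derivatives at `τ = 0` are one-sided. (The direction of the velocity `v` is
governed by the momentum constraints, its modulus by the equation for `V`.) -/
def IsSolution (γ : ℝ) (X : ℝ → State) : Prop :=
  ∃ R : ℝ → ℝ, ∀ τ : ℝ, 0 ≤ τ →
    InT γ (X τ) ∧
    0 = (X τ).N * R τ - √3 * (X τ).sigM * (X τ).Nbar ∧
    HasDerivWithinAt (fun t => (X t).sigP) (dSigP γ (X τ)) (Set.Ici 0) τ ∧
    HasDerivWithinAt (fun t => (X t).sigM) (dSigM γ (R τ) (X τ)) (Set.Ici 0) τ ∧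
    HasDerivWithinAt (fun t => (X t).sig12) (dSig12 γ (R τ) (X τ)) (Set.Ici 0) τ ∧
    HasDerivWithinAt (fun t => (X t).sig13) (dSig13 γ (R τ) (X τ)) (Set.Ici 0) τ ∧
    HasDerivWithinAt (fun t => (X t).sig23) (dSig23 γ (R τ) (X τ)) (Set.Ici 0) τ ∧
    HasDerivWithinAt (fun t => (X t).N) (dN γ (X τ)) (Set.Ici 0) τ ∧
    HasDerivWithinAt (fun t => (X t).Nbar) (dNbar γ (X τ)) (Set.Ici 0) τ ∧
    HasDerivWithinAt (fun t => (X t).Ω) (dΩ γ (X τ)) (Set.Ici 0) τ ∧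
    HasDerivWithinAt (fun t => (X t).V) (dV γ (X τ)) (Set.Ici 0) τ

/-- `ω(p) = C`: there is a solution curve on `[0, ∞)` that starts at `p`, and every such curve
converges to `C` as `τ → ∞`. -/
def FutureLimit (γ : ℝ) (p C : State) : Prop :=
  (∃ X : ℝ → State, IsSolution γ X ∧ X 0 = p) ∧
    ∀ X : ℝ → State, IsSolution γ X → X 0 = p → Filter.Tendsto X Filter.atTop (nhds C)

/-- The Collins VI₀ equilibrium `𝒞(VI₀)`. Its data fix only `N² = (3/16)(3γ-2)(2-γ)`; the two
equivalent points, interchanged by reversing the orientation of the frame, are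
told apart by the sign `ε = ±1` of `N`. -/
def collins (γ ε : ℝ) : State where
  sigP := -(1 / 4) * (3 * γ - 2)
  sigM := 0
  sig12 := 0
  sig13 := 0
  sig23 := 0
  N := ε * √(3 / 16 * (3 * γ - 2) * (2 - γ))
  Nbar := 0
  Ω := 3 / 4 * (2 - γ)
  v1 := 0
  v2 := 0
  v3 := 0

end TiltedVI0

end

/-! Put k = (3γ-2)/4, so 0 < k < 1/2, and G = 1+(γ-1)V². The proof rests on a strict Lyapunov
function and Barbalat-type arguments; no compactness of orbits or LaSalle principle is used.

Inside `InInterior` the momentum constraints force v₂ = v₃ = 0, hence V = |v₁| and 𝒮V = -2Σ₊V. Both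
N²-N̄² and Ω(1-V²)^{(2-γ)/2}/G then have explicit logarithmic derivatives, 2(q+2Σ₊) and 2q-(3γ-2).
Weighting the first by k and subtracting 2(1+k) log(1+kΣ₊) gives `lyapunov`. Its derivative is a sum
of nonnegative multiples of (Σ₊+k)², Σ₋²+Σ₂₃² and ΩV², divided by 1+kΣ₊ > 0
(`InInterior.dLyapunov_eq`). The function is bounded above by log Ω plus a constant
(`InInterior.lyapunov_le`), so it converges, and Ω stays away from 0.

Since all rates are bounded, `tendsto_zero_of_sq_le_deriv` yields Σ₊ → -k and Σ₋, Σ₂₃, V → 0. The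
remaining limits come from variables that already converge: as Σ₊ converges, the main term of Σ₊'
tends to 0, which fixes lim Ω; likewise Σ₂₃' gives NN̄ → 0 (`tendsto_zero_of_deriv_eq`). The
Hamiltonian constraint fixes lim N² = k(1-k) > 0, so N̄ → 0, and N never changes sign.

For existence, the equation NR₁ = √3Σ₋N̄ is desingularised by N̄ = uN, so R₁ = √3Σ₋u, and v₁ = sV
with a fixed sign s. The reduced field is smooth near the closed unit ball. It is cut off far out;
the constraints propagate because their residuals solve linear equations, and they confine the curve
to the unit ball, so the cutoff is never felt. -/

open Set Filter Topology

/-! ### Scalar differential inequalities -/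

/-- If `|z'| ≤ K |z|` on `[0, T]` then `z²` decays at most exponentially. -/
theorem sq_le_exp_mul_sq {z z' : ℝ → ℝ} {K T : ℝ} (hT : 0 ≤ T)
    (hz : ∀ t ∈ Icc 0 T, HasDerivWithinAt z (z' t) (Ici 0) t)
    (hb : ∀ t ∈ Icc 0 T, |z' t| ≤ K * |z t|) :
    z 0 ^ 2 ≤ Real.exp (2 * K * T) * z T ^ 2 := by
  have hE : ∀ t, HasDerivAt (fun t => Real.exp (2 * K * t)) (Real.exp (2 * K * t) * (2 * K)) t := by
    intro t
    simpa using ((hasDerivAt_id t).const_mul (2 * K)).exp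
  have hmono : MonotoneOn (fun t => Real.exp (2 * K * t) * z t ^ 2) (Icc 0 T) := by
    refine monotoneOn_of_hasDerivWithinAt_nonneg (convex_Icc 0 T) (f' := fun t =>
      Real.exp (2 * K * t) * (2 * K) * z t ^ 2 + Real.exp (2 * K * t) * (2 * z t * z' t)) ?_ ?_ ?_
    · intro t ht
      have h1 := (hz t ht).continuousWithinAt.mono (Icc_subset_Ici_self : Icc 0 T ⊆ Ici 0)
      exact (hE t).continuousAt.continuousWithinAt.mul (h1.pow 2)
    · intro t ht
      have ht' := interior_subset ht
      have h1 := (hz t ht').mono (s := interior (Icc 0 T))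
        (interior_subset.trans Icc_subset_Ici_self)
      have h2 := (hE t).hasDerivWithinAt.mul (h1.pow 2)
      exact h2.congr_deriv (by simp)
    · intro t ht
      have hb' := hb t (interior_subset ht)
      have : -(z t * z' t) ≤ K * z t ^ 2 := by
        calc -(z t * z' t) ≤ |z t * z' t| := neg_le_abs _
          _ = |z t| * |z' t| := abs_mul _ _
          _ ≤ |z t| * (K * |z t|) := by gcongr
          _ = K * |z t| ^ 2 := by ring
          _ = K * z t ^ 2 := by rw [sq_abs]
      have hpos := Real.exp_pos (2 * K * t)
      nlinarith
  have := hmono (left_mem_Icc.2 hT) (right_mem_Icc.2 hT) hT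
  simpa using this

/-- A solution of `|z'| ≤ K |z|` that is positive initially stays positive. -/
theorem pos_of_abs_deriv_le {z z' : ℝ → ℝ} {K T : ℝ} (hT : 0 ≤ T)
    (hz : ∀ t ∈ Icc 0 T, HasDerivWithinAt z (z' t) (Ici 0) t)
    (hb : ∀ t ∈ Icc 0 T, |z' t| ≤ K * |z t|) (h0 : 0 < z 0) : 0 < z T := by
  by_contra! hneg
  have hc : ContinuousOn z (Icc 0 T) := fun t ht =>
    (hz t ht).continuousWithinAt.mono Icc_subset_Ici_self
  obtain ⟨s, hs, hs0⟩ := intermediate_value_Icc' hT hc ⟨hneg, h0.le⟩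
  have := sq_le_exp_mul_sq hs.1 (fun t ht => hz t ⟨ht.1, ht.2.trans hs.2⟩)
    (fun t ht => hb t ⟨ht.1, ht.2.trans hs.2⟩)
  rw [hs0] at this
  nlinarith

/-- A solution of `|z'| ≤ K |z|` that vanishes initially vanishes. -/
theorem eq_zero_of_abs_deriv_le {z z' : ℝ → ℝ} {K T : ℝ} (hT : 0 ≤ T)
    (hz : ∀ t ∈ Icc 0 T, HasDerivWithinAt z (z' t) (Ici 0) t)
    (hb : ∀ t ∈ Icc 0 T, |z' t| ≤ K * |z t|) (h0 : z 0 = 0) : z T = 0 :=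
  eq_zero_of_abs_deriv_le_mul_abs_self_of_eq_zero_right
    (fun t ht => (hz t ht).continuousWithinAt.mono Icc_subset_Ici_self)
    (fun t ht => (hz t ⟨ht.1, ht.2.le⟩).mono (Ici_subset_Ici.2 ht.1)) h0
    (fun t ht => by simpa using hb t ⟨ht.1, ht.2.le⟩) T (right_mem_Icc.2 hT)

/-- A Barbalat-type lemma: if `x` converges and `x' ≥ h + e` with `e → 0` and `h` Lipschitz,
then `limsup h ≤ 0`. -/
theorem eventually_lt_of_le_deriv {x x' h h' e : ℝ → ℝ} {a K : ℝ} (hx : Tendsto x atTop (𝓝 a))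
    (hx' : ∀ t, 0 ≤ t → HasDerivWithinAt x (x' t) (Ici 0) t)
    (hle : ∀ t, 0 ≤ t → h t + e t ≤ x' t) (he : Tendsto e atTop (𝓝 0))
    (hh : ∀ t, 0 ≤ t → HasDerivWithinAt h (h' t) (Ici 0) t) (hK : ∀ t, 0 ≤ t → |h' t| ≤ K)
    {ε : ℝ} (hε : 0 < ε) : ∀ᶠ t in atTop, h t < ε := by
  have hK0 : 0 ≤ K := (abs_nonneg _).trans (hK 0 le_rfl)
  -- If h ≥ ε at time t, the Lipschitz bound keeps h ≥ ε/2 on [t, t+δ]. With e > -ε/4 this gives x'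
  -- ≥ ε/4, so x grows by at least εδ/4; but both endpoint values lie within εδ/8 of the limit.
  set δ := ε / (2 * (K + 1)) with hδ
  have hδ0 : 0 < δ := by positivity
  have hKδ : K * δ ≤ ε / 2 := by
    rw [hδ, mul_div_assoc', div_le_div_iff₀ (by positivity) (by positivity)]
    nlinarith
  have h1 : ∀ᶠ t in atTop, ∀ s, t ≤ s → -(ε / 4) < e s :=
    eventually_forall_ge_atTop.2 (he.eventually (lt_mem_nhds (by linarith : -(ε / 4) < 0)))
  have h2 : ∀ᶠ t in atTop, ∀ s, t ≤ s → |x s - a| < ε * δ / 8 := by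
    refine eventually_forall_ge_atTop.2 ?_
    have := (Metric.tendsto_nhds.1 hx) (ε * δ / 8) (by positivity)
    simpa [Real.dist_eq] using this
  filter_upwards [h1, h2, eventually_ge_atTop 0] with t h1 h2 ht
  by_contra! hcon
  have hlow : ∀ s ∈ Icc t (t + δ), ε / 2 ≤ h s := by
    intro s hs
    have := (convex_Ici (0 : ℝ)).norm_image_sub_le_of_norm_hasDerivWithin_le
      (fun r hr => hh r hr) (fun r hr => by simpa using hK r hr) (x := t) (y := s) ht
      (ht.trans hs.1)
    rw [Real.norm_eq_abs, Real.norm_eq_abs, abs_of_nonneg (sub_nonneg.2 hs.1)] at this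
    have h3 := (abs_le.1 this).1
    have : K * (s - t) ≤ K * δ := by
      gcongr
      linarith [hs.2]
    linarith
  have hgrow : MonotoneOn (fun s => x s - ε / 4 * s) (Icc t (t + δ)) := by
    refine monotoneOn_of_hasDerivWithinAt_nonneg (convex_Icc _ _)
      (f' := fun s => x' s - ε / 4) ?_ ?_ ?_
    · intro s hs
      have := (hx' s (ht.trans hs.1)).continuousWithinAt.mono
        (Icc_subset_Ici_self.trans (Ici_subset_Ici.2 ht) : Icc t (t + δ) ⊆ _)
      exact this.sub (by fun_prop)
    · intro s hs
      have hs' := interior_subset hs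
      have := (hx' s (ht.trans hs'.1)).mono (s := interior (Icc t (t + δ)))
        (interior_subset.trans (Icc_subset_Ici_self.trans (Ici_subset_Ici.2 ht)))
      exact (this.sub ((hasDerivAt_id s).const_mul (ε / 4)).hasDerivWithinAt).congr_deriv (by simp)
    · intro s hs
      have hs' := interior_subset hs
      have := hle s (ht.trans hs'.1)
      have := hlow s hs'
      have := h1 s hs'.1
      linarith
  have h3 := hgrow (left_mem_Icc.2 (by linarith)) (right_mem_Icc.2 (by linarith)) (by linarith)
  have h4 := abs_lt.1 (h2 t le_rfl)
  have h5 := abs_lt.1 (h2 (t + δ) (by linarith))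
  simp only at h3
  nlinarith

/-- If `x` converges and `x' = h + e` with `e → 0` and `h` Lipschitz, then `h → 0`. -/
theorem tendsto_zero_of_deriv_eq {x x' h h' e : ℝ → ℝ} {a K : ℝ} (hx : Tendsto x atTop (𝓝 a))
    (hx' : ∀ t, 0 ≤ t → HasDerivWithinAt x (x' t) (Ici 0) t)
    (heq : ∀ t, 0 ≤ t → x' t = h t + e t) (he : Tendsto e atTop (𝓝 0))
    (hh : ∀ t, 0 ≤ t → HasDerivWithinAt h (h' t) (Ici 0) t) (hK : ∀ t, 0 ≤ t → |h' t| ≤ K) :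
    Tendsto h atTop (𝓝 0) := by
  refine Metric.tendsto_nhds.2 fun ε hε => ?_
  have h1 := eventually_lt_of_le_deriv hx hx' (fun t ht => (heq t ht).ge) he hh hK hε
  have h2 := eventually_lt_of_le_deriv (e := fun t => -e t) (h := fun t => -h t) hx.neg
    (fun t ht => (hx' t ht).neg) (fun t ht => by rw [heq t ht]; linarith) (by simpa using he.neg)
    (fun t ht => (hh t ht).neg) (fun t ht => by simpa using hK t ht) hε
  filter_upwards [h1, h2] with t h1 h2
  rw [Real.dist_eq, sub_zero, abs_lt]
  exact ⟨by linarith, h1⟩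

/-- If `x` converges and `x' ≥ c h²` with `c > 0` and `h` bounded and Lipschitz, then `h → 0`. -/
theorem tendsto_zero_of_sq_le_deriv {x x' h h' : ℝ → ℝ} {a B K c : ℝ} (hc : 0 < c)
    (hx : Tendsto x atTop (𝓝 a))
    (hx' : ∀ t, 0 ≤ t → HasDerivWithinAt x (x' t) (Ici 0) t)
    (hle : ∀ t, 0 ≤ t → c * h t ^ 2 ≤ x' t)
    (hh : ∀ t, 0 ≤ t → HasDerivWithinAt h (h' t) (Ici 0) t) (hB : ∀ t, 0 ≤ t → |h t| ≤ B)
    (hK : ∀ t, 0 ≤ t → |h' t| ≤ K) : Tendsto h atTop (𝓝 0) := by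
  have hB0 : 0 ≤ B := (abs_nonneg _).trans (hB 0 le_rfl)
  refine Metric.tendsto_nhds.2 fun ε hε => ?_
  have h1 := eventually_lt_of_le_deriv (h := fun t => c * h t ^ 2) (e := fun _ => 0)
    (h' := fun t => c * (2 * h t * h' t)) (K := c * (2 * B * K)) hx hx'
    (fun t ht => by simpa using hle t ht) tendsto_const_nhds
    (fun t ht => by
      simpa using ((hh t ht).pow 2).const_mul c)
    (fun t ht => by
      rw [abs_mul, abs_mul, abs_mul, abs_of_pos hc, abs_two]
      have := hB t ht
      have := hK t ht
      gcongr) (ε := c * ε ^ 2) (by positivity)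
  filter_upwards [h1] with t h1
  rw [Real.dist_eq, sub_zero]
  exact abs_lt_of_sq_lt_sq (lt_of_mul_lt_mul_left h1 hc.le) hε.le

/-- A continuous function that, as long as it stays below `b`, satisfies the better bound `a < b`,
stays below `a` forever. -/
theorem le_of_forall_le_imp_le {f : ℝ → ℝ} {a b : ℝ} (hab : a < b) (hf : Continuous f)
    (h0 : f 0 ≤ a) (h : ∀ t, 0 ≤ t → (∀ s ∈ Icc 0 t, f s ≤ b) → f t ≤ a) {t : ℝ} (ht : 0 ≤ t) :
    f t ≤ a := by
  refine h t ht ?_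
  by_contra! hcon
  obtain ⟨s, hs, hfs⟩ := hcon
  have hcomp : IsCompact (Icc 0 t ∩ f ⁻¹' Ici b) :=
    isCompact_Icc.inter_right (isClosed_Ici.preimage hf)
  -- At the first time r with f ≥ b, the bound f ≤ b holds on all of [0, r], so the hypothesis gives
  -- f r ≤ a < b.
  obtain ⟨r, ⟨hr, hfr⟩, hmin⟩ := hcomp.exists_isLeast ⟨s, hs, hfs.le⟩
  have hbelow : ∀ u ∈ Icc 0 r, f u ≤ b := by
    intro u hu
    by_contra! hfu
    obtain ⟨w, hw, hfw⟩ := intermediate_value_Icc hu.1 hf.continuousOn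
      ⟨h0.trans hab.le, hfu.le⟩
    have h1 : r ≤ w := hmin ⟨⟨hw.1, (hw.2.trans hu.2).trans hr.2⟩, hfw.ge⟩
    have : w = u := le_antisymm hw.2 (hu.2.trans h1)
    rw [← this] at hfu
    linarith
  have := h r hr.1 hbelow
  have : b ≤ f r := hfr
  linarith

/-! ### Global solutions of ordinary differential equations -/

/-- A bounded Lipschitz vector field has a global integral curve through every point. -/
theorem exists_hasDerivAt_of_lipschitzWith_of_bounded {E : Type*} [NormedAddCommGroup E]
    [NormedSpace ℝ E] [CompleteSpace E] {f : E → E} {K : NNReal} (hf : LipschitzWith K f) {M : ℝ}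
    (hM : ∀ x, ‖f x‖ ≤ M) (x₀ : E) :
    ∃ α : ℝ → E, α 0 = x₀ ∧ ∀ t, HasDerivAt α (f (α t)) t := by
  have hM0 : 0 ≤ M := (norm_nonneg _).trans (hM 0)
  have hloc : ∀ n : ℕ, ∃ α : ℝ → E, α 0 = x₀ ∧
      ∀ t ∈ Ioo (-(n + 1 : ℝ)) (n + 1), HasDerivAt α (f (α t)) t := by
    intro n
    have hn : (0 : ℝ) < n + 1 := by positivity
    -- A field bounded by M cannot carry a curve further than M(n+1) in time n+1, so a ball of that
    -- radius serves.
    have hPL : IsPicardLindelof (fun _ => f) (tmin := -(n + 1 : ℝ)) (tmax := n + 1)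
        ⟨0, by constructor <;> linarith⟩ x₀ (M.toNNReal * (n + 1)) 0 M.toNNReal K :=
      .of_time_independent (fun x _ => by rw [Real.coe_toNNReal M hM0]; exact hM x)
        hf.lipschitzOnWith (by simp)
    obtain ⟨α, h0, hα⟩ := hPL.exists_eq_forall_mem_Icc_hasDerivWithinAt₀
    exact ⟨α, h0, fun t ht => (hα t (Ioo_subset_Icc_self ht)).hasDerivAt (Icc_mem_nhds ht.1 ht.2)⟩
  choose α h0 hα using hloc
  have heq : ∀ m n : ℕ, m ≤ n → EqOn (α m) (α n) (Ioo (-(m + 1 : ℝ)) (m + 1)) := by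
    intro m n hmn
    have hmn' : (m : ℝ) ≤ n := by exact_mod_cast hmn
    have hm : (0 : ℝ) < m + 1 := by positivity
    exact ODE_solution_unique_of_mem_Ioo (v := fun _ => f) (s := fun _ => univ) (K := K) (t₀ := 0)
      (fun _ _ => hf.lipschitzOnWith) ⟨by linarith, hm⟩ (fun t ht => ⟨hα m t ht, mem_univ _⟩)
      (fun t ht => ⟨hα n t ⟨by linarith [ht.1], by linarith [ht.2]⟩, mem_univ _⟩)
      ((h0 m).trans (h0 n).symm)
  -- The local solutions agree by uniqueness. Half-length n+1 instead of n keeps t in the open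
  -- interval of index ⌈|t|⌉₊.
  refine ⟨fun t => α ⌈|t|⌉₊ t, h0 _, fun t => ?_⟩
  have hmem : ∀ s : ℝ, s ∈ Ioo (-((⌈|s|⌉₊ : ℝ) + 1)) (⌈|s|⌉₊ + 1) := fun s =>
    abs_lt.1 ((Nat.le_ceil |s|).trans_lt (by linarith))
  have hev : (fun s => α ⌈|s|⌉₊ s) =ᶠ[𝓝 t] α ⌈|t|⌉₊ := by
    filter_upwards [Ioo_mem_nhds (hmem t).1 (hmem t).2] with s hs
    rcases le_total ⌈|s|⌉₊ ⌈|t|⌉₊ with h | h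
    · exact heq _ _ h (hmem s)
    · exact (heq _ _ h hs).symm
  exact (hα _ t (hmem t)).congr_of_eventuallyEq hev

/-- A vector field that is `C¹` near the closed ball of radius `b` can be cut off outside the closed
ball of radius `a < b`: through every point there is a global curve that is an integral curve as
long as it stays in the smaller ball. -/
theorem exists_hasDerivAt_of_contDiffAt_closedBall {E : Type*} [NormedAddCommGroup E]
    [NormedSpace ℝ E] [FiniteDimensional ℝ E] {f : E → E} {a b : ℝ} (ha : 0 < a) (hab : a < b)
    (hf : ∀ x, ‖x‖ ≤ b → ContDiffAt ℝ 1 f x) (x₀ : E) :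
    ∃ α : ℝ → E, α 0 = x₀ ∧ Continuous α ∧ ∀ t, ‖α t‖ ≤ a → HasDerivAt α (f (α t)) t := by
  have : CompleteSpace E := FiniteDimensional.complete ℝ E
  let χ : ContDiffBump (0 : E) := ⟨a, b, ha, hab⟩
  have hsupp : HasCompactSupport (fun x => χ x • f x) := χ.hasCompactSupport.smul_right
  have hC : ContDiff ℝ 1 (fun x => χ x • f x) := by
    rw [contDiff_iff_contDiffAt]
    intro x
    -- The topological support of χ is the closed ball of radius b, so smoothness of f is needed
    -- only there.
    by_cases hx : x ∈ tsupport χ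
    · rw [χ.tsupport_eq, mem_closedBall_zero_iff] at hx
      exact χ.contDiffAt.smul (hf x hx)
    · have : (fun x => χ x • f x) =ᶠ[𝓝 x] fun _ => 0 := by
        filter_upwards [notMem_tsupport_iff_eventuallyEq.1 hx] with y hy
        simp [hy]
      exact contDiffAt_const.congr_of_eventuallyEq this
  obtain ⟨K, hK⟩ := ContDiff.lipschitzWith_of_hasCompactSupport hsupp hC one_ne_zero
  obtain ⟨M, hM⟩ := hsupp.exists_bound_of_continuous hC.continuous
  obtain ⟨α, h0, hα⟩ := exists_hasDerivAt_of_lipschitzWith_of_bounded hK hM x₀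
  refine ⟨α, h0, continuous_iff_continuousAt.2 fun t => (hα t).continuousAt, fun t ht => ?_⟩
  have h1 := hα t
  rwa [χ.one_of_mem_closedBall (mem_closedBall_zero_iff.2 ht), one_smul] at h1

namespace TiltedVI0

open State

/-! ### Bounds on the state space -/

theorem State.V_nonneg (X : State) : 0 ≤ X.V := Real.sqrt_nonneg _

theorem State.V_sq (X : State) : X.V ^ 2 = X.v1 ^ 2 + X.v2 ^ 2 + X.v3 ^ 2 :=
  Real.sq_sqrt (by positivity)

theorem sqrt_three_lt_two : √3 < 2 := by
  rw [Real.sqrt_lt' two_pos]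
  norm_num

theorem abs_sqrt_three : |√3| = √3 := abs_of_nonneg (Real.sqrt_nonneg _)

section Bounds

variable {γ : ℝ} {X : State}

theorem InT.V_sq_le_one (h : InT γ X) : X.V ^ 2 ≤ 1 := by
  have := X.V_nonneg
  have := h.speed_le_one
  nlinarith

theorem InT.abs_sigP_le (h : InT γ X) : |X.sigP| ≤ 1 := by
  have := h.hamiltonian
  have := h.density_nonneg
  unfold shearSq at *
  exact abs_le_one_iff_mul_self_le_one.2 (by nlinarith)

theorem InT.abs_sigM_le (h : InT γ X) : |X.sigM| ≤ 1 := by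
  have := h.hamiltonian
  have := h.density_nonneg
  unfold shearSq at *
  exact abs_le_one_iff_mul_self_le_one.2 (by nlinarith)

theorem InT.abs_sig12_le (h : InT γ X) : |X.sig12| ≤ 1 := by
  have := h.hamiltonian
  have := h.density_nonneg
  unfold shearSq at *
  exact abs_le_one_iff_mul_self_le_one.2 (by nlinarith)

theorem InT.abs_sig13_le (h : InT γ X) : |X.sig13| ≤ 1 := by
  have := h.hamiltonian
  have := h.density_nonneg
  unfold shearSq at *
  exact abs_le_one_iff_mul_self_le_one.2 (by nlinarith)

theorem InT.abs_sig23_le (h : InT γ X) : |X.sig23| ≤ 1 := by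
  have := h.hamiltonian
  have := h.density_nonneg
  unfold shearSq at *
  exact abs_le_one_iff_mul_self_le_one.2 (by nlinarith)

theorem InT.abs_N_le (h : InT γ X) : |X.N| ≤ 1 := by
  have := h.hamiltonian
  have := h.density_nonneg
  unfold shearSq at *
  exact abs_le_one_iff_mul_self_le_one.2 (by nlinarith)

theorem InT.abs_Nbar_le_abs_N (h : InT γ X) : |X.Nbar| ≤ |X.N| :=
  sq_le_sq.1 h.typeVI0

theorem InT.abs_Nbar_le (h : InT γ X) : |X.Nbar| ≤ 1 :=
  h.abs_Nbar_le_abs_N.trans h.abs_N_le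

theorem InT.Ω_le (h : InT γ X) : X.Ω ≤ 1 := by
  have := h.hamiltonian
  unfold shearSq at *
  nlinarith

theorem InT.abs_v1_le (h : InT γ X) : |X.v1| ≤ 1 := by
  have := h.V_sq_le_one
  rw [X.V_sq] at this
  exact abs_le_one_iff_mul_self_le_one.2 (by nlinarith)

theorem InT.le_G (hγ : 2 / 3 < γ) (h : InT γ X) : 2 / 3 ≤ 1 + (γ - 1) * X.V ^ 2 := by
  nlinarith [h.V_sq_le_one, sq_nonneg X.V]

theorem InT.G_le (hγ' : γ < 4 / 3) (h : InT γ X) : 1 + (γ - 1) * X.V ^ 2 ≤ 4 / 3 := by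
  nlinarith [h.V_sq_le_one, sq_nonneg X.V]

theorem InT.le_D (hγ' : γ < 4 / 3) (h : InT γ X) : 2 / 3 ≤ 1 - (γ - 1) * X.V ^ 2 := by
  nlinarith [h.V_sq_le_one, sq_nonneg X.V]

theorem InT.q_nonneg (hγ : 2 / 3 < γ) (hγ' : γ < 4 / 3) (h : InT γ X) : 0 ≤ X.q γ := by
  have hG := h.le_G hγ
  have := h.density_nonneg
  have h1 : 0 ≤ 3 * γ - 2 + (2 - γ) * X.V ^ 2 := by nlinarith [sq_nonneg X.V]
  unfold q shearSq
  positivity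

/-- The fraction in q is at most 4, so q ≤ 2(Σ²+Ω), and the Hamiltonian constraint bounds this by 2.
-/
theorem InT.q_le (hγ : 2 / 3 < γ) (hγ' : γ < 4 / 3) (h : InT γ X) : X.q γ ≤ 2 := by
  have hG := h.le_G hγ
  have hΩ := h.density_nonneg
  have hV := h.V_sq_le_one
  have h1 : (3 * γ - 2 + (2 - γ) * X.V ^ 2) / (1 + (γ - 1) * X.V ^ 2) ≤ 4 := by
    rw [div_le_iff₀ (by linarith)]
    nlinarith [sq_nonneg X.V]
  have hH := h.hamiltonian
  unfold q
  nlinarith [mul_le_mul_of_nonneg_right h1 hΩ, sq_nonneg X.N]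

theorem InT.abs_q_sub_two_le (hγ : 2 / 3 < γ) (hγ' : γ < 4 / 3) (h : InT γ X) :
    |X.q γ - 2| ≤ 2 :=
  abs_le.2 ⟨by linarith [h.q_nonneg hγ hγ'], by linarith [h.q_le hγ hγ']⟩

theorem State.abs_c_le (X : State) (a : Fin 3) : |X.c a| ≤ 1 := by
  have hV := X.V_sq
  have key : ∀ x : ℝ, x ^ 2 ≤ X.V ^ 2 → |x / X.V| ≤ 1 := by
    intro x hx
    rw [abs_div, abs_of_nonneg X.V_nonneg]
    exact div_le_one_of_le₀ (abs_le_of_sq_le_sq hx X.V_nonneg) X.V_nonneg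
  fin_cases a <;> refine key _ ?_ <;> simp <;> nlinarith

theorem InT.abs_shearMatrix_le (h : InT γ X) (a b : Fin 3) : |X.shearMatrix a b| ≤ 3 := by
  have h3 := sqrt_three_lt_two
  have h0 := Real.sqrt_nonneg 3
  have hs : ∀ x : ℝ, |x| ≤ 1 → |√3 * x| ≤ 2 := by
    intro x hx
    rw [abs_mul, abs_sqrt_three]
    nlinarith [abs_nonneg x]
  have h1 := abs_le.1 h.abs_sigP_le
  have h2 := abs_le.1 (hs _ h.abs_sigM_le)
  have h4 := abs_le.1 (hs _ h.abs_sig12_le)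
  have h5 := abs_le.1 (hs _ h.abs_sig13_le)
  have h6 := abs_le.1 (hs _ h.abs_sig23_le)
  fin_cases a <;> fin_cases b <;> simp [shearMatrix, -abs_mul] <;> rw [abs_le] <;>
    constructor <;> linarith

theorem InT.abs_S_le (h : InT γ X) : |X.S| ≤ 27 := by
  have key : ∀ a b, |X.shearMatrix a b * X.c a * X.c b| ≤ 3 := by
    intro a b
    rw [abs_mul, abs_mul]
    have h1 := h.abs_shearMatrix_le a b
    have h2 := X.abs_c_le a
    have h3 := X.abs_c_le b
    calc _ ≤ (3 : ℝ) * 1 * 1 := by gcongr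
      _ = 3 := by norm_num
  calc |X.S| ≤ ∑ a : Fin 3, ∑ b : Fin 3, |X.shearMatrix a b * X.c a * X.c b| :=
        (Finset.abs_sum_le_sum_abs _ _).trans
          (Finset.sum_le_sum fun a _ => Finset.abs_sum_le_sum_abs _ _)
    _ ≤ ∑ a : Fin 3, ∑ b : Fin 3, (3 : ℝ) :=
        Finset.sum_le_sum fun a _ => Finset.sum_le_sum fun b _ => key a b
    _ = 27 := by norm_num

/-- R is the ratio √3Σ₋N̄/N with |N̄| ≤ |N|; strictness serves only to make N nonzero. No regularity
of R in time is assumed, so this bound is all that later estimates use. -/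
theorem InT.abs_rotation_le (h : InT γ X) (hN : X.Nbar ^ 2 < X.N ^ 2) {R : ℝ}
    (hR : 0 = X.N * R - √3 * X.sigM * X.Nbar) : |R| ≤ 2 := by
  have hN0 : 0 < |X.N| := abs_pos.2 fun h0 => by rw [h0] at hN; nlinarith [sq_nonneg X.Nbar]
  have h1 : |X.N| * |R| = √3 * |X.sigM| * |X.Nbar| := by
    rw [← abs_mul, (by linarith : X.N * R = √3 * X.sigM * X.Nbar), abs_mul, abs_mul,
      abs_sqrt_three]
  refine le_of_mul_le_mul_left ?_ hN0
  rw [h1]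
  have h2 := h.abs_sigM_le
  have h3 := h.abs_Nbar_le_abs_N
  calc √3 * |X.sigM| * |X.Nbar| ≤ 2 * 1 * |X.N| := by gcongr; exact sqrt_three_lt_two.le
    _ = |X.N| * 2 := by ring

/-- The factor |Ω| on the right is what preserves positivity of Ω; the constant is crude. -/
theorem InT.abs_dΩ_le (hγ : 2 / 3 < γ) (hγ' : γ < 4 / 3) (h : InT γ X) :
    |dΩ γ X| ≤ 100 * |X.Ω| := by
  have hG := h.le_G hγ
  have hq := h.q_nonneg hγ hγ'
  have hq' := h.q_le hγ hγ'
  have hV := h.V_sq_le_one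
  have hV0 := sq_nonneg X.V
  have hS : |γ * X.S| ≤ 36 := by
    rw [abs_mul, abs_of_pos (by linarith : 0 < γ)]
    nlinarith [h.abs_S_le, abs_nonneg X.S]
  have hqγ : |2 * X.q γ * (γ - 1)| ≤ 2 := by rw [abs_le]; constructor <;> nlinarith
  have h1 : |2 * X.q γ - (3 * γ - 2) + (2 * X.q γ * (γ - 1) - (2 - γ) - γ * X.S) * X.V ^ 2|
      ≤ 60 := by
    have h2 : |(2 * X.q γ * (γ - 1) - (2 - γ) - γ * X.S) * X.V ^ 2| ≤ 40 * 1 := by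
      rw [abs_mul, abs_of_nonneg hV0]
      have : |2 * X.q γ * (γ - 1) - (2 - γ) - γ * X.S| ≤ 40 := by
        rw [abs_le] at hS hqγ ⊢
        constructor <;> linarith
      gcongr
    rw [abs_le] at h2 ⊢
    constructor <;> linarith
  unfold dΩ
  rw [abs_mul, abs_div, abs_of_pos (by linarith : 0 < 1 + (γ - 1) * X.V ^ 2)]
  have h2 : |X.Ω| / (1 + (γ - 1) * X.V ^ 2) ≤ 3 / 2 * |X.Ω| := by
    rw [div_le_iff₀ (by linarith)]
    nlinarith [abs_nonneg X.Ω]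
  calc _ ≤ 3 / 2 * |X.Ω| * 60 := by gcongr
    _ ≤ 100 * |X.Ω| := by linarith [abs_nonneg X.Ω]

/-- The factor 1-V² keeps V from reaching 1 in finite time. -/
theorem InT.abs_dV_le (hγ : 2 / 3 < γ) (hγ' : γ < 4 / 3) (h : InT γ X) :
    |dV γ X| ≤ 50 * (1 - X.V ^ 2) := by
  have hD := h.le_D hγ'
  have hV := h.V_sq_le_one
  have h1 : |3 * γ - 4 - X.S| ≤ 30 := by
    have := abs_le.1 h.abs_S_le
    rw [abs_le]
    constructor <;> linarith
  unfold dV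
  rw [abs_mul, abs_div, abs_of_pos (by linarith : 0 < 1 - (γ - 1) * X.V ^ 2), abs_mul,
    abs_of_nonneg X.V_nonneg, abs_of_nonneg (sub_nonneg.2 hV)]
  have h2 : X.V * (1 - X.V ^ 2) / (1 - (γ - 1) * X.V ^ 2) ≤ 3 / 2 * (1 - X.V ^ 2) := by
    rw [div_le_iff₀ (by linarith)]
    nlinarith [X.V_nonneg, h.speed_le_one, mul_nonneg X.V_nonneg (sub_nonneg.2 hV),
      mul_nonneg (sub_nonneg.2 h.speed_le_one) (sub_nonneg.2 hV)]
  calc _ ≤ 3 / 2 * (1 - X.V ^ 2) * 30 := by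
        have := sub_nonneg.2 hV
        gcongr
    _ ≤ 50 * (1 - X.V ^ 2) := by linarith

/-- The term with N̄ is absorbed by |N̄| ≤ |N|; proportionality to |N| later shows that N keeps its
sign. -/
theorem InT.abs_dN_le (hγ : 2 / 3 < γ) (hγ' : γ < 4 / 3) (h : InT γ X) :
    |dN γ X| ≤ 8 * |X.N| := by
  have h1 : |X.q γ + 2 * X.sigP| ≤ 4 := by
    have := abs_le.1 h.abs_sigP_le
    rw [abs_le]
    constructor <;> linarith [h.q_nonneg hγ hγ', h.q_le hγ hγ']
  have h2 := h.abs_sig23_le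
  have h3 := h.abs_Nbar_le_abs_N
  unfold dN
  calc _ ≤ |(X.q γ + 2 * X.sigP) * X.N| + |2 * √3 * X.sig23 * X.Nbar| := abs_add_le _ _
    _ = |X.q γ + 2 * X.sigP| * |X.N| + 2 * √3 * |X.sig23| * |X.Nbar| := by
        simp only [abs_mul, abs_two, abs_sqrt_three]
    _ ≤ 4 * |X.N| + 2 * 2 * 1 * |X.N| := by gcongr; exact sqrt_three_lt_two.le
    _ = 8 * |X.N| := by ring

theorem InT.abs_dNbar_le (hγ : 2 / 3 < γ) (hγ' : γ < 4 / 3) (h : InT γ X) :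
    |dNbar γ X| ≤ 8 * |X.N| := by
  have h1 : |X.q γ + 2 * X.sigP| ≤ 4 := by
    have := abs_le.1 h.abs_sigP_le
    rw [abs_le]
    constructor <;> linarith [h.q_nonneg hγ hγ', h.q_le hγ hγ']
  have h2 := h.abs_sig23_le
  have h3 := h.abs_Nbar_le_abs_N
  unfold dNbar
  calc _ ≤ |(X.q γ + 2 * X.sigP) * X.Nbar| + |2 * √3 * X.sig23 * X.N| := abs_add_le _ _
    _ = |X.q γ + 2 * X.sigP| * |X.Nbar| + 2 * √3 * |X.sig23| * |X.N| := by
        simp only [abs_mul, abs_two, abs_sqrt_three]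
    _ ≤ 4 * |X.N| + 2 * 2 * 1 * |X.N| := by gcongr; exact sqrt_three_lt_two.le
    _ = 8 * |X.N| := by ring

end Bounds

/-! ### Invariance of the interior of `T₁(VI₀)` -/

/-- The states of one-component tilt with `Ω > 0`, `N̄² < N²` and `V < 1`. -/
structure InInterior (γ : ℝ) (X : State) : Prop extends InT1 γ X where
  density_pos : 0 < X.Ω
  Nbar_sq_lt : X.Nbar ^ 2 < X.N ^ 2
  speed_lt_one : X.V < 1

theorem hasDerivWithinAt_sq_sub_sq {f g : ℝ → ℝ} {f' g' t : ℝ} {s : Set ℝ}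
    (hf : HasDerivWithinAt f f' s t) (hg : HasDerivWithinAt g g' s t) :
    HasDerivWithinAt (fun t => f t ^ 2 - g t ^ 2) (2 * f t * f' - 2 * g t * g') s t :=
  ((hf.pow 2).sub (hg.pow 2)).congr_deriv (by simp)

theorem hasDerivWithinAt_sq_add_sq {f g : ℝ → ℝ} {f' g' t : ℝ} {s : Set ℝ}
    (hf : HasDerivWithinAt f f' s t) (hg : HasDerivWithinAt g g' s t) :
    HasDerivWithinAt (fun t => f t ^ 2 + g t ^ 2) (2 * f t * f' + 2 * g t * g') s t :=
  ((hf.pow 2).add (hg.pow 2)).congr_deriv (by simp)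

/-- A linear system with bounded coefficients: the growth of the square of the norm. -/
theorem abs_deriv_sq_add_sq_le {x y a b c d κ : ℝ} (ha : |a| ≤ κ) (hb : |b| ≤ κ) (hc : |c| ≤ κ)
    (hd : |d| ≤ κ) :
    |2 * x * (a * x + b * y) + 2 * y * (c * y + d * x)| ≤ 4 * κ * |x ^ 2 + y ^ 2| := by
  have h1 : |x * y| ≤ (x ^ 2 + y ^ 2) / 2 := by
    rw [abs_le]
    constructor <;> nlinarith [sq_nonneg (x - y), sq_nonneg (x + y)]
  have hκ : 0 ≤ κ := (abs_nonneg _).trans ha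
  rw [abs_of_nonneg (by positivity : 0 ≤ x ^ 2 + y ^ 2)]
  calc |2 * x * (a * x + b * y) + 2 * y * (c * y + d * x)|
      = |2 * (a * x ^ 2) + 2 * (c * y ^ 2) + 2 * ((b + d) * (x * y))| := by ring_nf
    _ ≤ |2 * (a * x ^ 2)| + |2 * (c * y ^ 2)| + |2 * ((b + d) * (x * y))| := abs_add_three _ _ _
    _ = 2 * (|a| * x ^ 2) + 2 * (|c| * y ^ 2) + 2 * (|b + d| * |x * y|) := by
        simp only [abs_mul, abs_two, abs_pow, sq_abs]
    _ ≤ 2 * (κ * x ^ 2) + 2 * (κ * y ^ 2) + 2 * ((κ + κ) * ((x ^ 2 + y ^ 2) / 2)) := by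
        have := (abs_add_le b d).trans (add_le_add hb hd)
        gcongr
    _ = 4 * κ * (x ^ 2 + y ^ 2) := by ring

/-- Each defining quantity satisfies |z'| ≤ K|z|. The inequality N̄² < N² must come before Σ₁₂ = Σ₁₃
= 0, because the linear system for (Σ₁₂, Σ₁₃) contains R, which is bounded only when N ≠ 0. -/
theorem IsSolution.inInterior {γ : ℝ} (hγ : 2 / 3 < γ) (hγ' : γ < 4 / 3) {X : ℝ → State}
    (hX : IsSolution γ X) (h0 : InInterior γ (X 0)) {τ : ℝ} (hτ : 0 ≤ τ) :
    InInterior γ (X τ) := by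
  obtain ⟨R, hX⟩ := hX
  have hT : ∀ t, 0 ≤ t → InT γ (X t) := fun t ht => (hX t ht).1
  have hZ : ∀ t, 0 ≤ t → (X t).Nbar ^ 2 < (X t).N ^ 2 := by
    intro t ht
    have := pos_of_abs_deriv_le (z := fun t => (X t).N ^ 2 - (X t).Nbar ^ 2) (K := 8) ht
      (fun s hs => by
        obtain ⟨-, -, -, -, -, -, -, hN, hNb, -⟩ := hX s hs.1
        exact hasDerivWithinAt_sq_sub_sq hN hNb)
      (fun s hs => by
        have h := hT s hs.1
        have h1 : |2 * ((X s).q γ + 2 * (X s).sigP)| ≤ 8 := by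
          have := abs_le.1 h.abs_sigP_le
          rw [abs_le]
          constructor <;> linarith [h.q_nonneg hγ hγ', h.q_le hγ hγ']
        have h2 : 2 * (X s).N * dN γ (X s) - 2 * (X s).Nbar * dNbar γ (X s)
            = 2 * ((X s).q γ + 2 * (X s).sigP) * ((X s).N ^ 2 - (X s).Nbar ^ 2) := by
          unfold dN dNbar
          ring
        rw [h2, abs_mul]
        gcongr)
      (sub_pos.2 h0.Nbar_sq_lt)
    linarith
  have hE : (X τ).sig12 ^ 2 + (X τ).sig13 ^ 2 = 0 := by
    refine eq_zero_of_abs_deriv_le (z := fun t => (X t).sig12 ^ 2 + (X t).sig13 ^ 2)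
      (K := 4 * 10) hτ
      (fun s hs => by
        obtain ⟨-, -, -, -, h12, h13, -⟩ := hX s hs.1
        exact hasDerivWithinAt_sq_add_sq h12 h13)
      (fun s hs => ?_) (by rw [h0.sig12_eq, h0.sig13_eq]; norm_num)
    obtain ⟨h, hR, -⟩ := hX s hs.1
    have h1 := abs_le.1 (h.abs_rotation_le (hZ s hs.1) hR)
    have h2 := abs_le.1 h.abs_sigP_le
    have hs3 : ∀ x : ℝ, |x| ≤ 1 → |√3 * x| ≤ 2 := by
      intro x hx
      rw [abs_mul, abs_sqrt_three]
      nlinarith [abs_nonneg x, sqrt_three_lt_two, Real.sqrt_nonneg 3]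
    have h3 := abs_le.1 (hs3 _ h.abs_sigM_le)
    have h4 := abs_le.1 (hs3 _ h.abs_sig23_le)
    have hmul : ∀ x y : ℝ, |x| ≤ 1 → |y| ≤ 1 → |√3 * x * y| ≤ 2 := by
      intro x y hx hy
      rw [mul_assoc]
      refine hs3 _ ?_
      rw [abs_mul]
      exact mul_le_one₀ hx (abs_nonneg _) hy
    have h5 := abs_le.1 (hmul _ _ h.abs_N_le h.abs_v1_le)
    have h6 := abs_le.1 (hmul _ _ h.abs_Nbar_le h.abs_v1_le)
    have h7 := h.q_nonneg hγ hγ'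
    have h8 := h.q_le hγ hγ'
    -- The largest coefficient is at most 2+3+2+2 = 9 in absolute value.
    have key := abs_deriv_sq_add_sq_le (x := (X s).sig12) (y := (X s).sig13) (κ := 10)
      (a := (X s).q γ - 2 - 3 * (X s).sigP - √3 * (X s).sigM + √3 * (X s).N * (X s).v1)
      (b := -(R s + √3 * (X s).sig23 - √3 * (X s).Nbar * (X s).v1))
      (c := (X s).q γ - 2 - 3 * (X s).sigP + √3 * (X s).sigM - √3 * (X s).N * (X s).v1)
      (d := -(-R s + √3 * (X s).sig23 + √3 * (X s).Nbar * (X s).v1))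
      (by rw [abs_le]; constructor <;> linarith) (by rw [abs_le]; constructor <;> linarith)
      (by rw [abs_le]; constructor <;> linarith) (by rw [abs_le]; constructor <;> linarith)
    convert key using 2
    unfold dSig12 dSig13
    ring
  have hΩ : 0 < (X τ).Ω :=
    pos_of_abs_deriv_le (z := fun t => (X t).Ω) hτ
      (fun s hs => (hX s hs.1).2.2.2.2.2.2.2.2.2.1)
      (fun s hs => (hT s hs.1).abs_dΩ_le hγ hγ') h0.density_pos
  have hV : 0 < 1 ^ 2 - (X τ).V ^ 2 := by
    refine pos_of_abs_deriv_le (z := fun t => 1 ^ 2 - (X t).V ^ 2) (K := 100) hτ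
      (fun s hs => hasDerivWithinAt_sq_sub_sq (hasDerivWithinAt_const _ _ _)
        (hX s hs.1).2.2.2.2.2.2.2.2.2.2) (fun s hs => ?_) ?_
    · have h := hT s hs.1
      have hV := h.V_sq_le_one
      rw [one_pow, abs_of_nonneg (sub_nonneg.2 hV)]
      have h1 := h.abs_dV_le hγ hγ'
      have h2 : |(X s).V * dV γ (X s)| ≤ 1 * (50 * (1 - (X s).V ^ 2)) := by
        rw [abs_mul, abs_of_nonneg (X s).V_nonneg]
        have := h.speed_le_one
        gcongr
      rw [abs_le] at h2 ⊢
      constructor <;> nlinarith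
    · have := h0.speed_lt_one
      have := (X 0).V_nonneg
      nlinarith
  refine ⟨⟨hT τ hτ, ?_, ?_⟩, hΩ, hZ τ hτ, ?_⟩
  · nlinarith [sq_nonneg (X τ).sig12, sq_nonneg (X τ).sig13]
  · nlinarith [sq_nonneg (X τ).sig12, sq_nonneg (X τ).sig13]
  · nlinarith [(X τ).V_nonneg]

/-! ### The monotone function -/

section Pointwise

variable {γ : ℝ} {X : State}

theorem InInterior.v2_eq (hγ : 2 / 3 < γ) (h : InInterior γ X) : X.v2 = 0 := by
  have h1 := h.momentum2
  rw [h.sig12_eq, h.sig13_eq] at h1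
  have h2 : γ * X.Ω * X.v2 = 0 := by linarith
  have := h.density_pos
  exact (mul_eq_zero.1 h2).resolve_left (by positivity)

theorem InInterior.v3_eq (hγ : 2 / 3 < γ) (h : InInterior γ X) : X.v3 = 0 := by
  have h1 := h.momentum3
  rw [h.sig12_eq, h.sig13_eq] at h1
  have h2 : γ * X.Ω * X.v3 = 0 := by linarith
  have := h.density_pos
  exact (mul_eq_zero.1 h2).resolve_left (by positivity)

theorem InInterior.V_eq (hγ : 2 / 3 < γ) (h : InInterior γ X) : X.V = |X.v1| := by
  rw [V, h.v2_eq hγ, h.v3_eq hγ, ← Real.sqrt_sq_eq_abs]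
  simp

theorem InInterior.V_sq_eq (hγ : 2 / 3 < γ) (h : InInterior γ X) : X.V ^ 2 = X.v1 ^ 2 := by
  rw [h.V_eq hγ, sq_abs]

/-- For a tilt along the first axis `𝒮 V = -2 Σ₊ V`. -/
theorem State.S_mul_V (X : State) (h2 : X.v2 = 0) (h3 : X.v3 = 0) :
    X.S * X.V = -2 * X.sigP * X.V := by
  -- For V = 0 the direction c is the default 0, so 𝒮 itself is not -2Σ₊; only the product with V is
  -- correct.
  by_cases hV : X.V = 0
  · simp [hV]
  · have h1 : X.c 0 ^ 2 = 1 := by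
      have := X.V_sq
      rw [h2, h3] at this
      simp only [c, Matrix.cons_val_zero, div_pow]
      rw [this]
      refine (div_eq_one_iff_eq fun h0 => hV ?_).2 (by ring)
      exact pow_eq_zero_iff two_ne_zero |>.1 (by rw [this]; linarith)
    have hc1 : X.c 1 = 0 := by simp [c, h2]
    have hc2 : X.c 2 = 0 := by simp [c, h3]
    have : X.S = -2 * X.sigP := by
      simp only [S, Fin.sum_univ_three, hc1, hc2, mul_zero, add_zero, zero_mul]
      simp only [shearMatrix, Matrix.of_apply, Matrix.cons_val_zero]
      linear_combination (-2 * X.sigP) * h1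
    rw [this]

theorem InInterior.S_mul_V (hγ : 2 / 3 < γ) (h : InInterior γ X) :
    X.S * X.V = -2 * X.sigP * X.V :=
  X.S_mul_V (h.v2_eq hγ) (h.v3_eq hγ)

/-- The Hamiltonian constraint eliminates N² and the first momentum constraint turns 2NΣ₋v₁ into
-γV²Ω/G. This exposes the factor 1+Σ₊ needed for the cancellation in `InInterior.dLyapunov_eq`. -/
theorem InInterior.dSigP_eq (hγ : 2 / 3 < γ) (h : InInterior γ X) :
    dSigP γ X = (X.q γ - 2) * (1 + X.sigP)
      + 3 / 2 * (2 - γ) * (1 - X.V ^ 2) * (X.Ω / (1 + (γ - 1) * X.V ^ 2)) := by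
  have hG := h.le_G hγ
  have hG0 : 1 + (γ - 1) * X.V ^ 2 ≠ 0 := by linarith
  have h1 := h.momentum1
  have hH := h.hamiltonian
  have hV := h.V_sq_eq hγ
  have h2 : 2 * X.N * X.sigM * X.v1 = -(γ * X.V ^ 2 * (X.Ω / (1 + (γ - 1) * X.V ^ 2))) := by
    rw [mul_div_assoc', ← neg_div, eq_div_iff hG0]
    linear_combination -X.v1 * h1 + γ * X.Ω * hV
  have hx : X.Ω = (1 + (γ - 1) * X.V ^ 2) * (X.Ω / (1 + (γ - 1) * X.V ^ 2)) := by field_simp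
  have hq : X.q γ = 2 * X.shearSq
      + 1 / 2 * (3 * γ - 2 + (2 - γ) * X.V ^ 2) * (X.Ω / (1 + (γ - 1) * X.V ^ 2)) := by
    unfold q
    ring
  unfold dSigP
  rw [h.sig12_eq, h.sig13_eq]
  linear_combination 2 * hH + h2 - hq + 2 * hx

/-- The logarithmic derivative of `Ω (1 - V²)^{(2-γ)/2} / G`. -/
theorem InInterior.logDeriv_density (hγ : 2 / 3 < γ) (hγ' : γ < 4 / 3) (h : InInterior γ X) :
    dΩ γ X / X.Ω - (2 - γ) * (X.V * dV γ X) / (1 - X.V ^ 2)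
      - 2 * (γ - 1) * (X.V * dV γ X) / (1 + (γ - 1) * X.V ^ 2) = 2 * X.q γ - (3 * γ - 2) := by
  have hG := h.le_G hγ
  have hD := h.le_D hγ'
  have hΩ := h.density_pos
  have hV : 0 < 1 - X.V ^ 2 := by nlinarith [h.speed_lt_one, X.V_nonneg]
  have hS := h.S_mul_V hγ
  have h1 : X.V * dV γ X = X.V ^ 2 * (1 - X.V ^ 2) / (1 - (γ - 1) * X.V ^ 2)
      * (3 * γ - 4 + 2 * X.sigP) := by
    unfold dV
    linear_combination (-X.V * (1 - X.V ^ 2) / (1 - (γ - 1) * X.V ^ 2)) * hS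
  have h2 : dΩ γ X = X.Ω / (1 + (γ - 1) * X.V ^ 2)
      * (2 * X.q γ - (3 * γ - 2)
        + (2 * X.q γ * (γ - 1) - (2 - γ) + 2 * γ * X.sigP) * X.V ^ 2) := by
    unfold dΩ
    linear_combination (-(X.Ω / (1 + (γ - 1) * X.V ^ 2)) * γ * X.V) * hS
  rw [h1, h2]
  generalize X.q γ = Q
  generalize X.V ^ 2 = w at *
  have hG0 : 1 + (γ - 1) * w ≠ 0 := by linarith
  have hD0 : 1 - (γ - 1) * w ≠ 0 := by linarith
  field_simp
  ring

/-- The monotone function (a logarithm of a product of powers). -/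
noncomputable def lyapunov (γ : ℝ) (X : State) : ℝ :=
  (3 * γ - 2) / 4 * Real.log (X.N ^ 2 - X.Nbar ^ 2)
    + (Real.log X.Ω + (2 - γ) / 2 * Real.log (1 - X.V ^ 2)
      - Real.log (1 + (γ - 1) * X.V ^ 2))
    - 2 * (1 + (3 * γ - 2) / 4) * Real.log (1 + (3 * γ - 2) / 4 * X.sigP)

/-- The derivative of the monotone function along solutions. -/
noncomputable def dLyapunov (γ : ℝ) (X : State) : ℝ :=
  (4 * (X.sigP + (3 * γ - 2) / 4) ^ 2
    + 4 * (1 - ((3 * γ - 2) / 4) ^ 2) * (X.sigM ^ 2 + X.sig23 ^ 2)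
    + 3 / 2 * γ * (2 - γ) * (1 + (3 * γ - 2) / 4) * X.V ^ 2 * (X.Ω / (1 + (γ - 1) * X.V ^ 2)))
    / (1 + (3 * γ - 2) / 4 * X.sigP)

theorem InInterior.one_add_sigP_pos (hγ : 2 / 3 < γ) (hγ' : γ < 4 / 3) (h : InInterior γ X) :
    1 - (3 * γ - 2) / 4 ≤ 1 + (3 * γ - 2) / 4 * X.sigP ∧ 1 + (3 * γ - 2) / 4 * X.sigP ≤ 2 := by
  have := abs_le.1 h.abs_sigP_le
  constructor <;> nlinarith

/-- After multiplication by 1+kΣ₊, k = (3γ-2)/4, the coefficient of q is the constant 2(1-k²): the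
weights are chosen so that its Σ₊-dependence cancels. The Ω/G terms without V² then cancel, and the
Σ₊ terms complete the square 4(Σ₊+k)². -/
theorem InInterior.dLyapunov_eq (hγ : 2 / 3 < γ) (hγ' : γ < 4 / 3) (h : InInterior γ X) :
    (3 * γ - 2) / 4 * (2 * (X.q γ + 2 * X.sigP)) + (2 * X.q γ - (3 * γ - 2))
      - 2 * (1 + (3 * γ - 2) / 4) * ((3 * γ - 2) / 4 * dSigP γ X
        / (1 + (3 * γ - 2) / 4 * X.sigP)) = dLyapunov γ X := by
  have h1 := (h.one_add_sigP_pos hγ hγ').1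
  have h0 : 1 + (3 * γ - 2) / 4 * X.sigP ≠ 0 := by linarith
  have hq : X.q γ = 2 * (X.sigP ^ 2 + X.sigM ^ 2 + X.sig23 ^ 2)
      + 1 / 2 * (3 * γ - 2 + (2 - γ) * X.V ^ 2) * (X.Ω / (1 + (γ - 1) * X.V ^ 2)) := by
    unfold q shearSq
    rw [h.sig12_eq, h.sig13_eq]
    ring
  rw [h.dSigP_eq hγ, hq]
  unfold dLyapunov
  generalize X.Ω / (1 + (γ - 1) * X.V ^ 2) = x
  -- In terms of k the only denominator left to clear, besides numerals, is 1+kΣ₊.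
  obtain ⟨k, rfl⟩ : ∃ k, γ = (4 * k + 2) / 3 := ⟨(3 * γ - 2) / 4, by ring⟩
  have hk : (3 * ((4 * k + 2) / 3) - 2) / 4 = k := by ring
  rw [hk] at h0 ⊢
  field_simp
  ring

end Pointwise

theorem IsSolution.hasDerivWithinAt_lyapunov {γ : ℝ} (hγ : 2 / 3 < γ) (hγ' : γ < 4 / 3)
    {X : ℝ → State} (hX : IsSolution γ X) (h0 : InInterior γ (X 0)) {τ : ℝ} (hτ : 0 ≤ τ) :
    HasDerivWithinAt (fun t => lyapunov γ (X t)) (dLyapunov γ (X τ)) (Ici 0) τ := by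
  have h := hX.inInterior hγ hγ' h0 hτ
  obtain ⟨R, hX⟩ := hX
  obtain ⟨-, -, hP, -, -, -, -, hN, hNb, hΩ, hV⟩ := hX τ hτ
  have hZ0 := sub_pos.2 h.Nbar_sq_lt
  have hG0 : 0 < 1 + (γ - 1) * (X τ).V ^ 2 := by linarith [h.le_G hγ]
  have hV0 : 0 < 1 - (X τ).V ^ 2 := by nlinarith [h.speed_lt_one, (X τ).V_nonneg]
  have hP0 := (h.one_add_sigP_pos hγ hγ').1
  have hP1 : 0 < 1 + (3 * γ - 2) / 4 * (X τ).sigP := by linarith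
  have d1 := ((hasDerivWithinAt_sq_sub_sq hN hNb).log hZ0.ne').const_mul ((3 * γ - 2) / 4)
  have d2 := hΩ.log h.density_pos.ne'
  have d3 := (((hV.pow 2).const_sub 1).log hV0.ne').const_mul ((2 - γ) / 2)
  have d4 := (((hV.pow 2).const_mul (γ - 1)).const_add 1).log hG0.ne'
  have d5 := ((((hP.const_mul ((3 * γ - 2) / 4)).const_add 1).log hP1.ne').const_mul
    (2 * (1 + (3 * γ - 2) / 4)))
  refine ((d1.add ((d2.add d3).sub d4)).sub d5).congr_deriv ?_
  rw [← h.dLyapunov_eq hγ hγ', ← h.logDeriv_density hγ hγ']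
  have e1 : (2 * (X τ).N * dN γ (X τ) - 2 * (X τ).Nbar * dNbar γ (X τ))
      / ((X τ).N ^ 2 - (X τ).Nbar ^ 2) = 2 * ((X τ).q γ + 2 * (X τ).sigP) := by
    rw [div_eq_iff hZ0.ne']
    unfold dN dNbar
    ring
  rw [e1]
  simp only [Pi.pow_apply, Nat.cast_ofNat, Nat.add_one_sub_one, pow_one]
  ring

/-- Keeping log Ω on the right lets one estimate serve twice: with Ω ≤ 1 it bounds the monotone
function above, and with monotonicity it bounds Ω below. -/
theorem InInterior.lyapunov_le {γ : ℝ} (hγ : 2 / 3 < γ) (hγ' : γ < 4 / 3) {X : State}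
    (h : InInterior γ X) : lyapunov γ X ≤ Real.log X.Ω - Real.log (2 / 3)
      - 2 * (1 + (3 * γ - 2) / 4) * Real.log (1 - (3 * γ - 2) / 4) := by
  have h1 : Real.log (X.N ^ 2 - X.Nbar ^ 2) ≤ 0 := by
    refine Real.log_nonpos (sub_nonneg.2 h.typeVI0) ?_
    have := abs_le_one_iff_mul_self_le_one.1 h.abs_N_le
    nlinarith [sq_nonneg X.Nbar]
  have hV0 : 0 < 1 - X.V ^ 2 := by nlinarith [h.speed_lt_one, X.V_nonneg]
  have h2 : Real.log (1 - X.V ^ 2) ≤ 0 := Real.log_nonpos hV0.le (by nlinarith [sq_nonneg X.V])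
  have h3 : Real.log (2 / 3) ≤ Real.log (1 + (γ - 1) * X.V ^ 2) :=
    Real.log_le_log (by norm_num) (h.le_G hγ)
  have h4 : Real.log (1 - (3 * γ - 2) / 4) ≤ Real.log (1 + (3 * γ - 2) / 4 * X.sigP) :=
    Real.log_le_log (by linarith) (h.one_add_sigP_pos hγ hγ').1
  have h5 : 2 * (1 + (3 * γ - 2) / 4) * Real.log (1 - (3 * γ - 2) / 4)
      ≤ 2 * (1 + (3 * γ - 2) / 4) * Real.log (1 + (3 * γ - 2) / 4 * X.sigP) := by
    gcongr
    linarith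
  have h6 : (3 * γ - 2) / 4 * Real.log (X.N ^ 2 - X.Nbar ^ 2) ≤ 0 :=
    mul_nonpos_of_nonneg_of_nonpos (by linarith) h1
  have h7 : (2 - γ) / 2 * Real.log (1 - X.V ^ 2) ≤ 0 :=
    mul_nonpos_of_nonneg_of_nonpos (by linarith) h2
  unfold lyapunov
  linarith

/-- The constants come from 1+kΣ₊ ≤ 2, G ≤ 4/3, 1-k² ≥ 1/2 and γ(2-γ) ≥ 8/9, the value at both ends
of the range of γ. -/
theorem InInterior.le_dLyapunov {γ : ℝ} (hγ : 2 / 3 < γ) (hγ' : γ < 4 / 3) {X : State}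
    (h : InInterior γ X) : 2 * (X.sigP + (3 * γ - 2) / 4) ^ 2 + (X.sigM ^ 2 + X.sig23 ^ 2)
      + 1 / 3 * X.Ω * X.V ^ 2 ≤ dLyapunov γ X := by
  obtain ⟨h1, h2⟩ := h.one_add_sigP_pos hγ hγ'
  have hG := h.le_G hγ
  have hG' := h.G_le hγ'
  have hΩ := h.density_pos
  have hx : 3 / 4 * X.Ω ≤ X.Ω / (1 + (γ - 1) * X.V ^ 2) := by
    rw [le_div_iff₀ (by linarith)]
    nlinarith
  have hx' : 3 / 4 * X.Ω * X.V ^ 2 ≤ X.V ^ 2 * (X.Ω / (1 + (γ - 1) * X.V ^ 2)) := by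
    nlinarith [mul_le_mul_of_nonneg_left hx (sq_nonneg X.V)]
  have hc : 8 / 9 ≤ 3 / 2 * γ * (2 - γ) * (1 + (3 * γ - 2) / 4) := by
    have : 8 / 9 ≤ γ * (2 - γ) := by nlinarith
    nlinarith
  have hk : 1 / 2 ≤ 1 - ((3 * γ - 2) / 4) ^ 2 := by nlinarith
  have h3 : 8 / 9 * (3 / 4 * X.Ω * X.V ^ 2) ≤ 3 / 2 * γ * (2 - γ) * (1 + (3 * γ - 2) / 4)
      * X.V ^ 2 * (X.Ω / (1 + (γ - 1) * X.V ^ 2)) := by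
    rw [mul_assoc (3 / 2 * γ * (2 - γ) * (1 + (3 * γ - 2) / 4))]
    exact mul_le_mul hc hx' (by positivity) (by linarith)
  have h4 : 4 * (1 / 2) * (X.sigM ^ 2 + X.sig23 ^ 2)
      ≤ 4 * (1 - ((3 * γ - 2) / 4) ^ 2) * (X.sigM ^ 2 + X.sig23 ^ 2) := by gcongr
  unfold dLyapunov
  rw [le_div_iff₀ (by linarith)]
  have h5 : 0 ≤ 2 * (X.sigP + (3 * γ - 2) / 4) ^ 2 + (X.sigM ^ 2 + X.sig23 ^ 2)
      + 1 / 3 * X.Ω * X.V ^ 2 := by positivity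
  calc _ ≤ (2 * (X.sigP + (3 * γ - 2) / 4) ^ 2 + (X.sigM ^ 2 + X.sig23 ^ 2)
      + 1 / 3 * X.Ω * X.V ^ 2) * 2 := by gcongr
    _ ≤ _ := by linarith

theorem tendsto_of_deriv_nonneg_of_bounded {f f' : ℝ → ℝ} {B : ℝ}
    (hf : ∀ t, 0 ≤ t → HasDerivWithinAt f (f' t) (Ici 0) t) (hf' : ∀ t, 0 ≤ t → 0 ≤ f' t)
    (hB : ∀ t, 0 ≤ t → f t ≤ B) : MonotoneOn f (Ici 0) ∧ ∃ a, Tendsto f atTop (𝓝 a) := by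
  have hm : MonotoneOn f (Ici 0) := by
    refine monotoneOn_of_hasDerivWithinAt_nonneg (convex_Ici 0) (f' := f')
      (fun t ht => (hf t ht).continuousWithinAt)
      (fun t ht => (hf t (interior_subset ht)).mono interior_subset)
      (fun t ht => hf' t (interior_subset ht))
  refine ⟨hm, ?_⟩
  -- Nothing is known of f at negative times; freezing it there gives a function monotone on all of
  -- ℝ.
  have hm' : Monotone fun t => f (max 0 t) := fun s t hst =>
    hm (le_max_left 0 s) (le_max_left 0 t) (max_le_max le_rfl hst)
  refine ⟨_, (tendsto_atTop_ciSup hm' ⟨B, ?_⟩).congr' ?_⟩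
  · rintro _ ⟨t, rfl⟩
    exact hB _ (le_max_left 0 t)
  · filter_upwards [eventually_ge_atTop 0] with t ht
    rw [max_eq_right ht]

/-! ### Convergence to the Collins equilibrium -/

section Rates

variable {γ : ℝ} {X : State}

theorem InInterior.abs_dSigP_le (hγ : 2 / 3 < γ) (hγ' : γ < 4 / 3) (h : InInterior γ X) :
    |dSigP γ X| ≤ 6 := by
  have h1 := h.abs_q_sub_two_le hγ hγ'
  have h2 := h.abs_sigP_le
  have h3 := h.abs_N_le
  have h4 := h.abs_sigM_le
  have h5 := h.abs_v1_le
  have e : dSigP γ X = (X.q γ - 2) * X.sigP + -(2 * (X.N * X.N)) + 2 * (X.N * X.sigM * X.v1) := by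
    unfold dSigP
    rw [h.sig12_eq, h.sig13_eq]
    ring
  rw [e]
  calc _ ≤ |(X.q γ - 2) * X.sigP| + |-(2 * (X.N * X.N))| + |2 * (X.N * X.sigM * X.v1)| :=
        abs_add_three _ _ _
    _ = |X.q γ - 2| * |X.sigP| + 2 * (|X.N| * |X.N|) + 2 * (|X.N| * |X.sigM| * |X.v1|) := by
        simp only [abs_mul, abs_neg, abs_two]
    _ ≤ 2 * 1 + 2 * (1 * 1) + 2 * (1 * 1 * 1) := by gcongr
    _ = 6 := by norm_num

theorem InInterior.abs_dSigM_le (hγ : 2 / 3 < γ) (hγ' : γ < 4 / 3) (h : InInterior γ X) {R : ℝ}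
    (hR : |R| ≤ 2) : |dSigM γ R X| ≤ 6 := by
  have h1 := h.abs_q_sub_two_le hγ hγ'
  have h2 := h.abs_sigM_le
  have h3 := h.abs_sig23_le
  have e : dSigM γ R X = (X.q γ - 2) * X.sigM + -(2 * (R * X.sig23)) := by
    unfold dSigM
    rw [h.sig12_eq, h.sig13_eq]
    ring
  rw [e]
  calc _ ≤ |(X.q γ - 2) * X.sigM| + |-(2 * (R * X.sig23))| := abs_add_le _ _
    _ = |X.q γ - 2| * |X.sigM| + 2 * (|R| * |X.sig23|) := by simp only [abs_mul, abs_neg, abs_two]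
    _ ≤ 2 * 1 + 2 * (2 * 1) := by gcongr
    _ = 6 := by norm_num

/-- The second summand tends to 0 along solutions, leaving NN̄ as the main term. -/
theorem InInterior.dSig23_eq (h : InInterior γ X) (R : ℝ) :
    dSig23 γ R X = -(2 * √3) * (X.N * X.Nbar)
      + ((X.q γ - 2) * X.sig23 + 2 * R * X.sigM) := by
  unfold dSig23
  rw [h.sig12_eq, h.sig13_eq]
  ring

theorem InInterior.abs_dSig23_le (hγ : 2 / 3 < γ) (hγ' : γ < 4 / 3) (h : InInterior γ X) {R : ℝ}
    (hR : |R| ≤ 2) : |dSig23 γ R X| ≤ 10 := by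
  have h1 := h.abs_q_sub_two_le hγ hγ'
  have h2 := h.abs_sigM_le
  have h3 := h.abs_sig23_le
  have h4 := h.abs_N_le
  have h5 := h.abs_Nbar_le
  rw [h.dSig23_eq, ← add_assoc]
  calc _ ≤ |-(2 * √3) * (X.N * X.Nbar)| + |(X.q γ - 2) * X.sig23| + |2 * R * X.sigM| :=
        abs_add_three _ _ _
    _ = 2 * √3 * (|X.N| * |X.Nbar|) + |X.q γ - 2| * |X.sig23| + 2 * |R| * |X.sigM| := by
        simp only [abs_mul, abs_neg, abs_two, abs_sqrt_three]
    _ ≤ 2 * 2 * (1 * 1) + 2 * 1 + 2 * 2 * 1 := by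
        gcongr
        exact sqrt_three_lt_two.le
    _ = 10 := by norm_num

end Rates

theorem tendsto_mul_zero_of_bounded {f g : ℝ → ℝ} {B : ℝ} (hf : ∀ t, 0 ≤ t → |f t| ≤ B)
    (hg : Tendsto g atTop (𝓝 0)) : Tendsto (fun t => f t * g t) atTop (𝓝 0) :=
  bdd_le_mul_tendsto_zero' B ((eventually_ge_atTop 0).mono hf) hg

theorem State.tendsto_iff {X : ℝ → State} {C : State} :
    Tendsto X atTop (𝓝 C) ↔ ∀ i, Tendsto (fun t => (X t).coords i) atTop (𝓝 (C.coords i)) := by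
  rw [nhds_induced, tendsto_comap_iff, tendsto_pi_nhds]
  rfl

theorem IsSolution.tendsto_collins {γ : ℝ} (hγ : 2 / 3 < γ) (hγ' : γ < 4 / 3) {X : ℝ → State}
    (hX : IsSolution γ X) (h0 : InInterior γ (X 0)) :
    Tendsto X atTop (𝓝 (collins γ (Real.sign (X 0).N))) := by
  have hI : ∀ t, 0 ≤ t → InInterior γ (X t) := fun t ht => hX.inInterior hγ hγ' h0 ht
  have hL : ∀ t, 0 ≤ t → HasDerivWithinAt (fun t => lyapunov γ (X t)) (dLyapunov γ (X t))
      (Ici 0) t := fun t ht => hX.hasDerivWithinAt_lyapunov hγ hγ' h0 ht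
  obtain ⟨R, hX⟩ := hX
  have dP : ∀ t, 0 ≤ t → HasDerivWithinAt (fun t => (X t).sigP) (dSigP γ (X t)) (Ici 0) t :=
    fun t ht => (hX t ht).2.2.1
  have dM : ∀ t, 0 ≤ t → HasDerivWithinAt (fun t => (X t).sigM) (dSigM γ (R t) (X t)) (Ici 0) t :=
    fun t ht => (hX t ht).2.2.2.1
  have d23 : ∀ t, 0 ≤ t →
      HasDerivWithinAt (fun t => (X t).sig23) (dSig23 γ (R t) (X t)) (Ici 0) t :=
    fun t ht => (hX t ht).2.2.2.2.2.2.1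
  have dN' : ∀ t, 0 ≤ t → HasDerivWithinAt (fun t => (X t).N) (dN γ (X t)) (Ici 0) t :=
    fun t ht => (hX t ht).2.2.2.2.2.2.2.1
  have dNb : ∀ t, 0 ≤ t → HasDerivWithinAt (fun t => (X t).Nbar) (dNbar γ (X t)) (Ici 0) t :=
    fun t ht => (hX t ht).2.2.2.2.2.2.2.2.1
  have dΩ' : ∀ t, 0 ≤ t → HasDerivWithinAt (fun t => (X t).Ω) (dΩ γ (X t)) (Ici 0) t :=
    fun t ht => (hX t ht).2.2.2.2.2.2.2.2.2.1
  have dV' : ∀ t, 0 ≤ t → HasDerivWithinAt (fun t => (X t).V) (dV γ (X t)) (Ici 0) t :=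
    fun t ht => (hX t ht).2.2.2.2.2.2.2.2.2.2
  have hR : ∀ t, 0 ≤ t → |R t| ≤ 2 := fun t ht =>
    (hI t ht).abs_rotation_le (hI t ht).Nbar_sq_lt (hX t ht).2.1
  -- the monotone function converges
  set B := -Real.log (2 / 3) - 2 * (1 + (3 * γ - 2) / 4) * Real.log (1 - (3 * γ - 2) / 4) with hB
  have hLB : ∀ t, 0 ≤ t → lyapunov γ (X t) ≤ Real.log (X t).Ω + B := fun t ht => by
    linarith [(hI t ht).lyapunov_le hγ hγ']
  have hL0 : ∀ t, 0 ≤ t → 0 ≤ dLyapunov γ (X t) := fun t ht => by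
    have := (hI t ht).density_pos
    exact le_trans (by positivity) ((hI t ht).le_dLyapunov hγ hγ')
  obtain ⟨hmono, ℓ, hℓ⟩ := tendsto_of_deriv_nonneg_of_bounded (B := B) hL hL0 fun t ht => by
    have := Real.log_nonpos (hI t ht).density_nonneg (hI t ht).Ω_le
    linarith [hLB t ht]
  -- the density is bounded away from zero
  have hΩ0 : ∀ t, 0 ≤ t → Real.exp (lyapunov γ (X 0) - B) ≤ (X t).Ω := fun t ht => by
    rw [← Real.le_log_iff_exp_le (hI t ht).density_pos]
    have : lyapunov γ (X 0) ≤ lyapunov γ (X t) := hmono self_mem_Ici ht ht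
    linarith [hLB t ht]
  have hk : |(3 * γ - 2) / 4| ≤ 1 := by rw [abs_le]; constructor <;> linarith
  have tP' : Tendsto (fun t => (X t).sigP + (3 * γ - 2) / 4) atTop (𝓝 0) := by
    refine tendsto_zero_of_sq_le_deriv (c := 2) (B := 1 + 1) two_pos hℓ hL (fun t ht => ?_)
      (fun t ht => (dP t ht).add_const _)
      (fun t ht => (abs_add_le _ _).trans (add_le_add (hI t ht).abs_sigP_le hk))
      (fun t ht => (hI t ht).abs_dSigP_le hγ hγ')
    have := (hI t ht).le_dLyapunov hγ hγ'
    have := (hI t ht).density_pos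
    have : 0 ≤ 1 / 3 * (X t).Ω * (X t).V ^ 2 := by positivity
    nlinarith [sq_nonneg (X t).sigM, sq_nonneg (X t).sig23]
  have tP : Tendsto (fun t => (X t).sigP) atTop (𝓝 (-((3 * γ - 2) / 4))) := by
    simpa using tP'.sub_const ((3 * γ - 2) / 4)
  have tM : Tendsto (fun t => (X t).sigM) atTop (𝓝 0) := by
    refine tendsto_zero_of_sq_le_deriv (c := 1) one_pos hℓ hL (fun t ht => ?_) dM
      (fun t ht => (hI t ht).abs_sigM_le)
      (fun t ht => (hI t ht).abs_dSigM_le hγ hγ' (hR t ht))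
    have := (hI t ht).le_dLyapunov hγ hγ'
    have := (hI t ht).density_pos
    have : 0 ≤ 1 / 3 * (X t).Ω * (X t).V ^ 2 := by positivity
    nlinarith [sq_nonneg ((X t).sigP + (3 * γ - 2) / 4), sq_nonneg (X t).sig23]
  have t23 : Tendsto (fun t => (X t).sig23) atTop (𝓝 0) := by
    refine tendsto_zero_of_sq_le_deriv (c := 1) one_pos hℓ hL (fun t ht => ?_) d23
      (fun t ht => (hI t ht).abs_sig23_le)
      (fun t ht => (hI t ht).abs_dSig23_le hγ hγ' (hR t ht))
    have := (hI t ht).le_dLyapunov hγ hγ'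
    have := (hI t ht).density_pos
    have : 0 ≤ 1 / 3 * (X t).Ω * (X t).V ^ 2 := by positivity
    nlinarith [sq_nonneg ((X t).sigP + (3 * γ - 2) / 4), sq_nonneg (X t).sigM]
  -- The dissipation controls only ΩV²; the lower bound on Ω turns it into control of V².
  have tV : Tendsto (fun t => (X t).V) atTop (𝓝 0) := by
    refine tendsto_zero_of_sq_le_deriv (c := 1 / 3 * Real.exp (lyapunov γ (X 0) - B)) (B := 1)
      (K := 50) (by positivity) hℓ hL (fun t ht => ?_) dV'
      (fun t ht => by rw [abs_of_nonneg (X t).V_nonneg]; exact (hI t ht).speed_le_one)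
      (fun t ht => ((hI t ht).abs_dV_le hγ hγ').trans (by linarith [sq_nonneg (X t).V]))
    have := (hI t ht).le_dLyapunov hγ hγ'
    have := mul_le_mul_of_nonneg_right (hΩ0 t ht) (sq_nonneg (X t).V)
    nlinarith [sq_nonneg ((X t).sigP + (3 * γ - 2) / 4), sq_nonneg (X t).sigM,
      sq_nonneg (X t).sig23]
  have hΩabs : ∀ t, 0 ≤ t → |(X t).Ω| ≤ 1 := fun t ht => by
    rw [abs_of_pos (hI t ht).density_pos]
    exact (hI t ht).Ω_le
  have tSq : Tendsto (fun t => (X t).sigP ^ 2 + (X t).sigM ^ 2 + (X t).sig23 ^ 2) atTop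
      (𝓝 (((3 * γ - 2) / 4) ^ 2)) := by
    simpa using ((tP.pow 2).add (tM.pow 2)).add (t23.pow 2)
  -- Inserting Σ₊ = -k and Σ₋ = Σ₂₃ = V = 0 in Σ₊' leaves 2(1-k²)(Ω-(1-k)), where 1-k = (3/4)(2-γ).
  -- The error consists of an Ω-free part `tA` and Ω times `tB`.
  have tΩ' : Tendsto (fun t => 2 * (1 - ((3 * γ - 2) / 4) ^ 2) *
      ((X t).Ω - 3 / 4 * (2 - γ))) atTop (𝓝 0) := by
    have tG : Tendsto (fun t => 1 + (γ - 1) * (X t).V ^ 2) atTop (𝓝 1) := by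
      simpa using ((tV.pow 2).const_mul (γ - 1)).const_add 1
    have tA : Tendsto (fun t => (2 * ((X t).sigP ^ 2 + (X t).sigM ^ 2 + (X t).sig23 ^ 2) - 2)
        * (1 + (X t).sigP) + 2 * (1 - ((3 * γ - 2) / 4) ^ 2) * (3 / 4 * (2 - γ))) atTop (𝓝 0) := by
      convert ((((tSq.const_mul 2).sub_const 2).mul (tP.const_add 1)).add_const
        (2 * (1 - ((3 * γ - 2) / 4) ^ 2) * (3 / 4 * (2 - γ)))) using 2
      ring
    have tB : Tendsto (fun t => 1 / 2 * ((3 * γ - 2 + (2 - γ) * (X t).V ^ 2)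
        / (1 + (γ - 1) * (X t).V ^ 2)) * (1 + (X t).sigP)
        + 3 / 2 * (2 - γ) * ((1 - (X t).V ^ 2) / (1 + (γ - 1) * (X t).V ^ 2))
        - 2 * (1 - ((3 * γ - 2) / 4) ^ 2)) atTop (𝓝 0) := by
      convert ((((((((tV.pow 2).const_mul (2 - γ)).const_add (3 * γ - 2)).div tG
        one_ne_zero).const_mul (1 / 2)).mul (tP.const_add 1)).add
        ((((tV.pow 2).const_sub 1).div tG one_ne_zero).const_mul (3 / 2 * (2 - γ)))).sub_const
        (2 * (1 - ((3 * γ - 2) / 4) ^ 2))) using 2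
      · simp only [Pi.div_apply]
      · ring
    refine tendsto_zero_of_deriv_eq tP dP (fun t ht => ?_)
      (by simpa using tA.add (tendsto_mul_zero_of_bounded hΩabs tB))
      (fun t ht => ((dΩ' t ht).sub_const _).const_mul _)
      (K := 2 * (1 - ((3 * γ - 2) / 4) ^ 2) * (100 * 1)) (fun t ht => ?_)
    · rw [(hI t ht).dSigP_eq hγ]
      unfold q shearSq
      rw [(hI t ht).sig12_eq, (hI t ht).sig13_eq]
      ring
    · have h1 : 0 ≤ 2 * (1 - ((3 * γ - 2) / 4) ^ 2) := by nlinarith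
      rw [abs_mul, abs_of_nonneg h1]
      have h2 := (hI t ht).abs_dΩ_le hγ hγ'
      have h3 := hΩabs t ht
      gcongr
      linarith
  have tΩ : Tendsto (fun t => (X t).Ω) atTop (𝓝 (3 / 4 * (2 - γ))) := by
    have h1 : 2 * (1 - ((3 * γ - 2) / 4) ^ 2) ≠ 0 := by nlinarith
    have := (tΩ'.const_mul (2 * (1 - ((3 * γ - 2) / 4) ^ 2))⁻¹).add_const (3 / 4 * (2 - γ))
    rw [mul_zero, zero_add] at this
    refine this.congr fun t => ?_
    rw [inv_mul_cancel_left₀ h1]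
    ring
  have tNN : Tendsto (fun t => (X t).N * (X t).Nbar) atTop (𝓝 0) := by
    have te : Tendsto (fun t => ((X t).q γ - 2) * (X t).sig23 + 2 * R t * (X t).sigM) atTop
        (𝓝 0) := by
      have h1 := tendsto_mul_zero_of_bounded
        (fun t ht => (hI t ht).abs_q_sub_two_le hγ hγ') t23
      have h2 := tendsto_mul_zero_of_bounded (f := fun t => 2 * R t) (B := 2 * 2)
        (fun t ht => by
          rw [abs_mul, abs_two]
          have := hR t ht
          gcongr) tM
      simpa using h1.add h2
    have h3 := tendsto_zero_of_deriv_eq (K := 2 * √3 * (8 + 8)) t23 d23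
      (fun t ht => (hI t ht).dSig23_eq (R t)) te
      (fun t ht => ((dN' t ht).mul (dNb t ht)).const_mul (-(2 * √3))) (fun t ht => by
        have h := hI t ht
        have h1 : |dN γ (X t)| ≤ 8 * 1 := (h.abs_dN_le hγ hγ').trans (by gcongr; exact h.abs_N_le)
        have h2 : |dNbar γ (X t)| ≤ 8 * 1 :=
          (h.abs_dNbar_le hγ hγ').trans (by gcongr; exact h.abs_N_le)
        have h3 := h.abs_N_le
        have h4 := h.abs_Nbar_le
        rw [abs_mul, abs_neg, abs_mul, abs_two, abs_sqrt_three]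
        gcongr
        refine (abs_add_le _ _).trans ?_
        rw [abs_mul, abs_mul]
        calc _ ≤ 8 * 1 * 1 + 1 * (8 * 1) := by gcongr
          _ = (8 : ℝ) + 8 := by norm_num)
    have h4 : -(2 * √3) ≠ 0 := by simp
    have := h3.const_mul (-(2 * √3))⁻¹
    rw [mul_zero] at this
    exact this.congr fun t => inv_mul_cancel_left₀ h4 _
  have hlim : 0 < 3 / 16 * (3 * γ - 2) * (2 - γ) := by
    have : 0 < 3 * γ - 2 := by linarith
    have : 0 < 2 - γ := by linarith
    positivity
  have tN2 : Tendsto (fun t => (X t).N ^ 2) atTop (𝓝 (3 / 16 * (3 * γ - 2) * (2 - γ))) := by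
    have := (tSq.const_sub 1).sub tΩ
    rw [(by ring : 1 - ((3 * γ - 2) / 4) ^ 2 - 3 / 4 * (2 - γ)
      = 3 / 16 * (3 * γ - 2) * (2 - γ))] at this
    refine this.congr' ?_
    filter_upwards [eventually_ge_atTop 0] with t ht
    have h := (hI t ht).hamiltonian
    unfold shearSq at h
    rw [(hI t ht).sig12_eq, (hI t ht).sig13_eq] at h
    linarith
  have tabsN : Tendsto (fun t => |(X t).N|) atTop (𝓝 √(3 / 16 * (3 * γ - 2) * (2 - γ))) := by
    simpa only [Real.sqrt_sq_eq_abs] using tN2.sqrt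
  have tN : Tendsto (fun t => (X t).N) atTop
      (𝓝 (Real.sign (X 0).N * √(3 / 16 * (3 * γ - 2) * (2 - γ)))) := by
    -- Only |N| has a limit so far; |N'| ≤ 8|N| fixes the sign of N for all time.
    have hN0 : (X 0).N ≠ 0 := fun hz => by
      have := h0.Nbar_sq_lt
      rw [hz] at this
      nlinarith [sq_nonneg (X 0).Nbar]
    refine (tabsN.const_mul (Real.sign (X 0).N)).congr' ?_
    filter_upwards [eventually_ge_atTop 0] with t ht
    rcases lt_or_gt_of_ne hN0 with hneg | hpos
    · have := pos_of_abs_deriv_le (z := fun t => -(X t).N) (K := 8) ht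
        (fun s hs => (dN' s hs.1).neg)
        (fun s hs => by simpa only [abs_neg] using (hI s hs.1).abs_dN_le hγ hγ')
        (by linarith)
      rw [Real.sign_of_neg hneg, abs_of_neg (by linarith)]
      ring
    · have := pos_of_abs_deriv_le (z := fun t => (X t).N) (K := 8) ht
        (fun s hs => dN' s hs.1) (fun s hs => (hI s hs.1).abs_dN_le hγ hγ') hpos
      rw [Real.sign_of_pos hpos, abs_of_pos this, one_mul]
  have tNb : Tendsto (fun t => (X t).Nbar) atTop (𝓝 0) := by
    have h1 : Real.sign (X 0).N * √(3 / 16 * (3 * γ - 2) * (2 - γ)) ≠ 0 := by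
      intro hz
      have := tN.pow 2
      rw [hz] at this
      have := tendsto_nhds_unique this tN2
      linarith
    have := tNN.div tN h1
    rw [zero_div] at this
    refine this.congr' ?_
    filter_upwards [tN.eventually_ne h1] with t ht
    exact mul_div_cancel_left₀ _ ht
  have tv1 : Tendsto (fun t => (X t).v1) atTop (𝓝 0) := by
    rw [tendsto_zero_iff_abs_tendsto_zero]
    refine tV.congr' ?_
    filter_upwards [eventually_ge_atTop 0] with t ht
    exact (hI t ht).V_eq hγ
  have tz : ∀ f : ℝ → ℝ, (∀ t, 0 ≤ t → f t = 0) → Tendsto f atTop (𝓝 0) := fun f hf =>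
    tendsto_const_nhds.congr' <| by
      filter_upwards [eventually_ge_atTop 0] with t ht
      exact (hf t ht).symm
  rw [State.tendsto_iff]
  intro i
  fin_cases i
  · change Tendsto (fun t => (X t).sigP) atTop (𝓝 (-(1 / 4) * (3 * γ - 2)))
    convert tP using 2
    ring
  · exact tM
  · exact tz _ fun t ht => (hI t ht).sig12_eq
  · exact tz _ fun t ht => (hI t ht).sig13_eq
  · exact t23
  · exact tN
  · exact tNb
  · exact tΩ
  · exact tv1
  · exact tz _ fun t ht => (hI t ht).v2_eq hγ
  · exact tz _ fun t ht => (hI t ht).v3_eq hγ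

/-! ### Existence of solution curves

With `N̄ = u N` and `v₁ = s V`, `s = ±1`, the equations for one-component tilt become a regular
system for `(Σ₊, Σ₋, Σ₂₃, N, u, Ω, V)`, the coordinates `0, …, 6` of a vector in `ℝ⁷`. -/

/-- The deceleration parameter in reduced coordinates. -/
noncomputable def reducedQ (γ : ℝ) (y : Fin 7 → ℝ) : ℝ :=
  2 * (y 0 ^ 2 + y 1 ^ 2 + y 2 ^ 2)
    + 1 / 2 * ((3 * γ - 2 + (2 - γ) * y 6 ^ 2) / (1 + (γ - 1) * y 6 ^ 2)) * y 5

/-- The logarithmic derivative of the density in reduced coordinates. -/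
noncomputable def reducedRate (γ : ℝ) (y : Fin 7 → ℝ) : ℝ :=
  (2 * reducedQ γ y - (3 * γ - 2)
    + (2 * reducedQ γ y * (γ - 1) - (2 - γ) + 2 * γ * y 0) * y 6 ^ 2) / (1 + (γ - 1) * y 6 ^ 2)

/-- The evolution equations in reduced coordinates. -/
noncomputable def reducedField (γ s : ℝ) (y : Fin 7 → ℝ) : Fin 7 → ℝ :=
  ![(reducedQ γ y - 2) * y 0 - 2 * y 3 ^ 2 + 2 * y 3 * y 1 * (s * y 6),
    (reducedQ γ y - 2) * y 1 - 2 * (√3 * y 1 * y 4) * y 2,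
    (reducedQ γ y - 2) * y 2 - 2 * √3 * (y 4 * y 3) * y 3 + 2 * (√3 * y 1 * y 4) * y 1,
    (reducedQ γ y + 2 * y 0) * y 3 + 2 * √3 * y 2 * (y 4 * y 3),
    2 * √3 * y 2 * (1 - y 4 ^ 2),
    reducedRate γ y * y 5,
    (1 - y 6 ^ 2) / (1 - (γ - 1) * y 6 ^ 2) * (3 * γ - 4 + 2 * y 0) * y 6]

/-- The constraints in reduced coordinates. -/
structure Admissible (γ s : ℝ) (y : Fin 7 → ℝ) : Prop where
  hamiltonian : 1 - (y 0 ^ 2 + y 1 ^ 2 + y 2 ^ 2 + y 3 ^ 2 + y 5) = 0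
  momentum : 2 * (y 1 * y 3) + γ * s * (y 5 * y 6 / (1 + (γ - 1) * y 6 ^ 2)) = 0
  density_pos : 0 < y 5
  ratio_sq_lt : 0 < 1 - y 4 ^ 2
  speed_sq_lt : 0 < 1 - y 6 ^ 2
  speed_nonneg : 0 ≤ y 6

/-- Here |γ-1| < 1/3 and V² ≤ 9/4, so |(γ-1)V²| ≤ 3/4. The radius 3/2 leaves room for a cutoff
outside the unit ball. -/
theorem denominators_ne_zero {γ : ℝ} (hγ : 2 / 3 < γ) (hγ' : γ < 4 / 3) {y : Fin 7 → ℝ}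
    (hy : ‖y‖ ≤ 3 / 2) : 1 + (γ - 1) * y 6 ^ 2 ≠ 0 ∧ 1 - (γ - 1) * y 6 ^ 2 ≠ 0 := by
  have h1 := abs_le.1 ((norm_le_pi_norm y 6).trans hy)
  have h2 : y 6 ^ 2 ≤ 9 / 4 := by nlinarith
  have h3 := sq_nonneg (y 6)
  constructor <;> nlinarith

theorem contDiffAt_reducedQ {γ : ℝ} (hγ : 2 / 3 < γ) (hγ' : γ < 4 / 3) {y : Fin 7 → ℝ}
    (hy : ‖y‖ ≤ 3 / 2) : ContDiffAt ℝ 1 (reducedQ γ) y := by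
  obtain ⟨hG, -⟩ := denominators_ne_zero hγ hγ' hy
  unfold reducedQ
  fun_prop (disch := assumption)

theorem contDiffAt_reducedRate {γ : ℝ} (hγ : 2 / 3 < γ) (hγ' : γ < 4 / 3) {y : Fin 7 → ℝ}
    (hy : ‖y‖ ≤ 3 / 2) : ContDiffAt ℝ 1 (reducedRate γ) y := by
  obtain ⟨hG, -⟩ := denominators_ne_zero hγ hγ' hy
  have := contDiffAt_reducedQ hγ hγ' hy
  unfold reducedRate
  fun_prop (disch := assumption)

theorem contDiffAt_reducedField {γ s : ℝ} (hγ : 2 / 3 < γ) (hγ' : γ < 4 / 3) {y : Fin 7 → ℝ}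
    (hy : ‖y‖ ≤ 3 / 2) : ContDiffAt ℝ 1 (reducedField γ s) y := by
  obtain ⟨hG, hD⟩ := denominators_ne_zero hγ hγ' hy
  have hq := contDiffAt_reducedQ hγ hγ' hy
  have hr := contDiffAt_reducedRate hγ hγ' hy
  rw [contDiffAt_pi]
  intro i
  fin_cases i
  all_goals
    simp only [reducedField, Fin.zero_eta, Fin.mk_one, Fin.reduceFinMk, Matrix.cons_val]
    fun_prop (disch := assumption)

/-! ### Propagation of the constraints along the reduced system -/

section Invariance

variable {γ s r T : ℝ} {α : ℝ → Fin 7 → ℝ} {z : ℝ → ℝ} {A : (Fin 7 → ℝ) → ℝ}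

theorem exists_abs_mul_le (hA : ∀ y, ‖y‖ ≤ r → ContDiffAt ℝ 1 A y)
    (hα : ∀ t ∈ Icc 0 T, ‖α t‖ ≤ r) :
    ∃ K, ∀ t ∈ Icc 0 T, |A (α t) * z t| ≤ K * |z t| := by
  obtain ⟨K, hK⟩ := (isCompact_closedBall (0 : Fin 7 → ℝ) r).exists_bound_of_continuousOn
    (f := A) fun y hy => (hA y (mem_closedBall_zero_iff.1 hy)).continuousAt.continuousWithinAt
  refine ⟨K, fun t ht => ?_⟩
  rw [abs_mul]
  gcongr
  exact hK _ (mem_closedBall_zero_iff.2 (hα t ht))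

theorem pos_of_deriv_eq_mul (hT : 0 ≤ T) (hA : ∀ y, ‖y‖ ≤ r → ContDiffAt ℝ 1 A y)
    (hα : ∀ t ∈ Icc 0 T, ‖α t‖ ≤ r) (hz : ∀ t ∈ Icc 0 T, HasDerivAt z (A (α t) * z t) t)
    (h0 : 0 < z 0) : 0 < z T := by
  obtain ⟨K, hK⟩ := exists_abs_mul_le (z := z) hA hα
  exact pos_of_abs_deriv_le hT (fun t ht => (hz t ht).hasDerivWithinAt) hK h0

theorem eq_zero_of_deriv_eq_mul (hT : 0 ≤ T) (hA : ∀ y, ‖y‖ ≤ r → ContDiffAt ℝ 1 A y)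
    (hα : ∀ t ∈ Icc 0 T, ‖α t‖ ≤ r) (hz : ∀ t ∈ Icc 0 T, HasDerivAt z (A (α t) * z t) t)
    (h0 : z 0 = 0) : z T = 0 := by
  obtain ⟨K, hK⟩ := exists_abs_mul_le (z := z) hA hα
  exact eq_zero_of_abs_deriv_le hT (fun t ht => (hz t ht).hasDerivWithinAt) hK h0

/-- Every constraint residual, and every quantity required to be positive, solves z' = A z with A
continuous on the ball, so zeros and signs persist. -/
theorem Admissible.of_hasDerivAt (hγ : 2 / 3 < γ) (hγ' : γ < 4 / 3) (hs : s ^ 2 = 1)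
    (hT : 0 ≤ T) (hα : ∀ t ∈ Icc 0 T, ‖α t‖ ≤ 3 / 2)
    (hd : ∀ t ∈ Icc 0 T, HasDerivAt α (reducedField γ s (α t)) t)
    (h0 : Admissible γ s (α 0)) : Admissible γ s (α T) := by
  have hGD := fun (y : Fin 7 → ℝ) (hy : ‖y‖ ≤ 3 / 2) => denominators_ne_zero hγ hγ' hy
  have hd' : ∀ i, ∀ t ∈ Icc 0 T, HasDerivAt (fun t => α t i) (reducedField γ s (α t) i) t :=
    fun i t ht => hasDerivAt_pi.1 (hd t ht) i
  have hw : 0 ≤ α T 6 := by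
    have hA : ∀ y : Fin 7 → ℝ, ‖y‖ ≤ 3 / 2 → ContDiffAt ℝ 1 (fun y : Fin 7 → ℝ =>
        (1 - y 6 ^ 2) / (1 - (γ - 1) * y 6 ^ 2) * (3 * γ - 4 + 2 * y 0)) y := by
      intro y hy
      obtain ⟨hG, hD⟩ := hGD y hy
      fun_prop (disch := assumption)
    rcases h0.speed_nonneg.eq_or_lt with h | h
    · exact (eq_zero_of_deriv_eq_mul hT hA hα (hd' 6) h.symm).ge
    · exact (pos_of_deriv_eq_mul hT hA hα (hd' 6) h).le
  have hw1 : 0 < 1 - α T 6 ^ 2 := by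
    refine pos_of_deriv_eq_mul (z := fun t => 1 - α t 6 ^ 2) (A := fun y =>
      -2 * y 6 ^ 2 / (1 - (γ - 1) * y 6 ^ 2) * (3 * γ - 4 + 2 * y 0)) hT (fun y hy => ?_) hα
      (fun t ht => ?_) h0.speed_sq_lt
    · obtain ⟨hG, hD⟩ := hGD y hy
      fun_prop (disch := assumption)
    · refine (((hd' 6 t ht).pow 2).const_sub 1).congr_deriv ?_
      simp only [reducedField, Matrix.cons_val]
      ring
  have hu : 0 < 1 - α T 4 ^ 2 := by
    refine pos_of_deriv_eq_mul (z := fun t => 1 - α t 4 ^ 2) (A := fun y =>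
      -4 * √3 * y 4 * y 2) hT (fun y hy => by fun_prop) hα (fun t ht => ?_) h0.ratio_sq_lt
    refine (((hd' 4 t ht).pow 2).const_sub 1).congr_deriv ?_
    simp only [reducedField, Matrix.cons_val]
    ring
  have hΩ : 0 < α T 5 :=
    pos_of_deriv_eq_mul (z := fun t => α t 5) (A := reducedRate γ) hT
      (fun y hy => contDiffAt_reducedRate hγ hγ' hy) hα (hd' 5) h0.density_pos
  -- The momentum constraint is needed at every time, because the Hamiltonian residual satisfies z'
  -- = 2q z only modulo it.
  have hC : ∀ t ∈ Icc 0 T, 2 * (α t 1 * α t 3)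
      + γ * s * (α t 5 * α t 6 / (1 + (γ - 1) * α t 6 ^ 2)) = 0 := by
    intro T' hT'
    refine eq_zero_of_deriv_eq_mul (z := fun t => 2 * (α t 1 * α t 3)
      + γ * s * (α t 5 * α t 6 / (1 + (γ - 1) * α t 6 ^ 2)))
      (A := fun y => 2 * reducedQ γ y - 2 + 2 * y 0) hT'.1 (fun y hy => ?_)
      (fun t ht => hα t ⟨ht.1, ht.2.trans hT'.2⟩) (fun t ht => ?_) h0.momentum
    · have := contDiffAt_reducedQ hγ hγ' hy
      fun_prop
    · have ht' : t ∈ Icc 0 T := ⟨ht.1, ht.2.trans hT'.2⟩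
      obtain ⟨hG, hD⟩ := hGD _ (hα t ht')
      refine ((((hd' 1 t ht').mul (hd' 3 t ht')).const_mul 2).add
        ((((hd' 5 t ht').mul (hd' 6 t ht')).div
          ((((hd' 6 t ht').pow 2).const_mul (γ - 1)).const_add 1) hG).const_mul
            (γ * s))).congr_deriv ?_
      simp only [reducedField, reducedRate, Matrix.cons_val, Pi.mul_apply, Pi.pow_apply,
        Nat.cast_ofNat, Nat.add_one_sub_one, pow_one]
      generalize reducedQ γ (α t) = Q
      field_simp
      ring
  have hH : 1 - (α T 0 ^ 2 + α T 1 ^ 2 + α T 2 ^ 2 + α T 3 ^ 2 + α T 5) = 0 := by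
    refine eq_zero_of_deriv_eq_mul
      (z := fun t => 1 - (α t 0 ^ 2 + α t 1 ^ 2 + α t 2 ^ 2 + α t 3 ^ 2 + α t 5))
      (A := fun y => 2 * reducedQ γ y) hT (fun y hy => ?_) hα (fun t ht => ?_) h0.hamiltonian
    · have := contDiffAt_reducedQ hγ hγ' hy
      fun_prop
    · obtain ⟨hG, hD⟩ := hGD _ (hα t ht)
      refine (((((((hd' 0 t ht).pow 2).add ((hd' 1 t ht).pow 2)).add ((hd' 2 t ht).pow 2)).add
        ((hd' 3 t ht).pow 2)).add (hd' 5 t ht)).const_sub 1).congr_deriv ?_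
      have hq : reducedQ γ (α t) = 2 * (α t 0 ^ 2 + α t 1 ^ 2 + α t 2 ^ 2)
        + 1 / 2 * ((3 * γ - 2 + (2 - γ) * α t 6 ^ 2) / (1 + (γ - 1) * α t 6 ^ 2)) * α t 5 := rfl
      have hrate : reducedRate γ (α t) = 2 * reducedQ γ (α t)
          - (3 * γ - 2 + (2 - γ) * α t 6 ^ 2) / (1 + (γ - 1) * α t 6 ^ 2)
          + 2 * γ * α t 0 * (α t 6 ^ 2 / (1 + (γ - 1) * α t 6 ^ 2)) := by
        unfold reducedRate
        field_simp
        ring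
      have hm := hC t ht
      simp only [reducedField, Matrix.cons_val, Nat.cast_ofNat, Nat.add_one_sub_one, pow_one]
      rw [hrate]
      linear_combination (-2 * α t 0 * s * α t 6) * hm - 2 * hq
        + (2 * α t 0 * α t 6 ^ 2 * γ * α t 5 / (1 + (γ - 1) * α t 6 ^ 2)) * hs
  exact ⟨hH, hC T (right_mem_Icc.2 hT), hΩ, hu, hw1, hw⟩

end Invariance

/-- The a priori bound that closes the continuation argument in `exists_isSolution`. -/
theorem Admissible.norm_le_one {γ s : ℝ} {y : Fin 7 → ℝ} (h : Admissible γ s y) : ‖y‖ ≤ 1 := by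
  have h1 := h.hamiltonian
  have h2 := h.density_pos
  have h3 := h.ratio_sq_lt
  have h4 := h.speed_sq_lt
  rw [pi_norm_le_iff_of_nonneg zero_le_one]
  intro i
  rw [Real.norm_eq_abs]
  refine abs_le_one_iff_mul_self_le_one.2 ?_
  fin_cases i <;> simp only [Fin.zero_eta, Fin.mk_one, Fin.reduceFinMk] <;> nlinarith

/-- The state with the given reduced coordinates. -/
def ofReduced (s : ℝ) (y : Fin 7 → ℝ) : State where
  sigP := y 0
  sigM := y 1
  sig12 := 0
  sig13 := 0
  sig23 := y 2
  N := y 3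
  Nbar := y 4 * y 3
  Ω := y 5
  v1 := s * y 6
  v2 := 0
  v3 := 0

/-! ### From reduced coordinates back to states -/

section OfReduced

variable {γ s : ℝ} {y : Fin 7 → ℝ}

theorem Admissible.V_eq (hs : s ^ 2 = 1) (h : Admissible γ s y) : (ofReduced s y).V = y 6 := by
  have : (s * y 6) ^ 2 + 0 ^ 2 + 0 ^ 2 = y 6 ^ 2 := by rw [mul_pow, hs]; ring
  rw [V]
  simp only [ofReduced, this]
  exact Real.sqrt_sq h.speed_nonneg

theorem Admissible.q_eq (hs : s ^ 2 = 1) (h : Admissible γ s y) :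
    (ofReduced s y).q γ = reducedQ γ y := by
  rw [q, h.V_eq hs, reducedQ]
  simp only [shearSq, ofReduced]
  ring

theorem Admissible.S_mul_speed (hs : s ^ 2 = 1) (h : Admissible γ s y) :
    (ofReduced s y).S * y 6 = -2 * y 0 * y 6 := by
  have := (ofReduced s y).S_mul_V rfl rfl
  rwa [h.V_eq hs] at this

theorem Admissible.inT (hγ : 2 / 3 < γ) (hγ' : γ < 4 / 3) (hs : s ^ 2 = 1)
    (h : Admissible γ s y) : InT γ (ofReduced s y) := by
  have h4 := h.speed_sq_lt
  have hG := (denominators_ne_zero hγ hγ' (h.norm_le_one.trans (by norm_num))).1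
  have hm := h.momentum
  have hH := h.hamiltonian
  refine ⟨?_, ?_, ?_, ?_, h.density_pos.le, ?_, ?_⟩
  · simp only [shearSq, ofReduced]
    linarith
  · rw [h.V_eq hs]
    simp only [ofReduced]
    have e := div_mul_cancel₀ (y 5 * y 6) hG
    linear_combination -(1 + (γ - 1) * y 6 ^ 2) * hm + γ * s * e
  · simp [ofReduced]
  · simp [ofReduced]
  · simp only [ofReduced]
    nlinarith [h.ratio_sq_lt, sq_nonneg (y 3)]
  · rw [h.V_eq hs]
    nlinarith [h.speed_nonneg]

end OfReduced

theorem isSolution_ofReduced {γ s : ℝ} (hγ : 2 / 3 < γ) (hγ' : γ < 4 / 3) (hs : s ^ 2 = 1)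
    {α : ℝ → Fin 7 → ℝ} (hα : ∀ t, 0 ≤ t → Admissible γ s (α t))
    (hd : ∀ t, 0 ≤ t → HasDerivAt α (reducedField γ s (α t)) t) :
    IsSolution γ fun t => ofReduced s (α t) := by
  -- The rotation R₁ = √3Σ₋u solves NR₁ = √3Σ₋N̄ without division by N.
  refine ⟨fun t => √3 * α t 1 * α t 4, fun τ hτ => ?_⟩
  have h := hα τ hτ
  have hV := h.V_eq hs
  have hq := h.q_eq hs
  have hS := h.S_mul_speed hs
  have hd' : ∀ i, HasDerivWithinAt (fun t => α t i) (reducedField γ s (α τ) i) (Ici 0) τ :=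
    fun i => (hasDerivAt_pi.1 (hd τ hτ) i).hasDerivWithinAt
  refine ⟨h.inT hγ hγ' hs, ?_, (hd' 0).congr_deriv ?_, (hd' 1).congr_deriv ?_, ?_, ?_,
    (hd' 2).congr_deriv ?_, (hd' 3).congr_deriv ?_, ((hd' 4).mul (hd' 3)).congr_deriv ?_,
    (hd' 5).congr_deriv ?_,
    ((hd' 6).congr_deriv ?_).congr (fun t ht => (hα t ht).V_eq hs) hV⟩
  · simp only [ofReduced]
    ring
  · rw [dSigP, hq]
    simp only [reducedField, ofReduced, Matrix.cons_val]
    ring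
  · rw [dSigM, hq]
    simp only [reducedField, ofReduced, Matrix.cons_val]
    ring
  · refine (hasDerivWithinAt_const τ _ (0 : ℝ)).congr_deriv ?_
    simp [dSig12, ofReduced]
  · refine (hasDerivWithinAt_const τ _ (0 : ℝ)).congr_deriv ?_
    simp [dSig13, ofReduced]
  · rw [dSig23, hq]
    simp only [reducedField, ofReduced, Matrix.cons_val]
    ring
  · rw [dN, hq]
    simp only [reducedField, ofReduced, Matrix.cons_val]
  · rw [dNbar, hq]
    simp only [reducedField, ofReduced, Matrix.cons_val]
    ring
  · rw [dΩ, hq, hV]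
    simp only [reducedField, reducedRate, Matrix.cons_val]
    change _ = α τ 5 / _ * _
    linear_combination (α τ 5 / (1 + (γ - 1) * α τ 6 ^ 2) * γ * α τ 6) * hS
  · rw [dV, hV]
    simp only [reducedField, Matrix.cons_val]
    linear_combination ((1 - α τ 6 ^ 2) / (1 - (γ - 1) * α τ 6 ^ 2)) * hS

theorem exists_isSolution {γ : ℝ} (hγ : 2 / 3 < γ) (hγ' : γ < 4 / 3) {p : State}
    (hp : InInterior γ p) : ∃ X : ℝ → State, IsSolution γ X ∧ X 0 = p := by
  -- A fixed sign suffices, since V' is proportional to V and v₁ cannot cross 0; `Real.sign` would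
  -- violate s² = 1 when v₁ = 0.
  obtain ⟨s, hs, hsv⟩ : ∃ s : ℝ, s ^ 2 = 1 ∧ s * |p.v1| = p.v1 := by
    rcases le_total 0 p.v1 with h | h
    · exact ⟨1, by norm_num, by rw [abs_of_nonneg h, one_mul]⟩
    · exact ⟨-1, by norm_num, by rw [abs_of_nonpos h]; ring⟩
  have hN : p.N ≠ 0 := fun hz => by
    have := hp.Nbar_sq_lt
    rw [hz] at this
    nlinarith [sq_nonneg p.Nbar]
  have hG := hp.le_G hγ
  rw [hp.V_eq hγ] at hG
  have hG0 : 1 + (γ - 1) * |p.v1| ^ 2 ≠ 0 := by linarith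
  set y₀ : Fin 7 → ℝ := ![p.sigP, p.sigM, p.sig23, p.N, p.Nbar / p.N, p.Ω, |p.v1|] with hy₀
  have hy : Admissible γ s y₀ := by
    refine ⟨?_, ?_, hp.density_pos, ?_, ?_, abs_nonneg _⟩ <;> simp only [hy₀, Matrix.cons_val]
    · have := hp.hamiltonian
      rw [shearSq, hp.sig12_eq, hp.sig13_eq] at this
      linarith
    · have := hp.momentum1
      rw [hp.V_eq hγ] at this
      have e := div_mul_cancel₀ (p.Ω * |p.v1|) hG0
      refine mul_right_cancel₀ hG0 ?_
      linear_combination -this + γ * s * e + γ * p.Ω * hsv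
    · rw [div_pow, sub_pos, div_lt_one (by positivity)]
      exact hp.Nbar_sq_lt
    · rw [← hp.V_eq hγ]
      nlinarith [hp.speed_lt_one, p.V_nonneg]
  obtain ⟨α, h0, hc, hd⟩ := exists_hasDerivAt_of_contDiffAt_closedBall (a := 5 / 4) (b := 3 / 2)
    (by norm_num) (by norm_num) (fun y hy => contDiffAt_reducedField (s := s) hγ hγ' hy) y₀
  have hadm : ∀ t, 0 ≤ t → (∀ r ∈ Icc 0 t, ‖α r‖ ≤ 5 / 4) → Admissible γ s (α t) :=
    fun t ht hb => Admissible.of_hasDerivAt hγ hγ' hs ht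
      (fun r hr => (hb r hr).trans (by norm_num)) (fun r hr => hd r (hb r hr)) (h0 ▸ hy)
  -- Bootstrap: as long as the norm is at most 5/4, the curve solves the uncut system, hence is
  -- admissible, hence has norm at most 1.
  have hb : ∀ t, 0 ≤ t → ‖α t‖ ≤ 1 := fun t ht =>
    le_of_forall_le_imp_le (f := fun t => ‖α t‖) (b := 5 / 4) (by norm_num) hc.norm
      (by simpa only [h0] using hy.norm_le_one) (fun r hr hr' => (hadm r hr hr').norm_le_one) ht
  have hb' : ∀ t, 0 ≤ t → ‖α t‖ ≤ 5 / 4 := fun t ht => (hb t ht).trans (by norm_num)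
  refine ⟨_, isSolution_ofReduced hγ hγ' hs (fun t ht => hadm t ht fun r hr => hb' r hr.1)
    fun t ht => hd t (hb' t ht), ?_⟩
  ext
  all_goals simp only [ofReduced, h0, hy₀, Matrix.cons_val]
  · exact hp.sig12_eq.symm
  · exact hp.sig13_eq.symm
  · exact div_mul_cancel₀ _ hN
  · exact hsv
  · exact (hp.v2_eq hγ).symm
  · exact (hp.v3_eq hγ).symm

end TiltedVI0

/-! ### The theorem on global attractors -/

theorem mainTheorem2 (γ : ℝ) (hγ : 2 / 3 < γ) (hγ' : γ < 4 / 3)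
    (p : TiltedVI0.State) (hp : TiltedVI0.InT1 γ p)
    (hΩ : 0 < p.Ω) (hN : p.Nbar ^ 2 < p.N ^ 2) (hV : p.V < 1) :
    TiltedVI0.FutureLimit γ p (TiltedVI0.collins γ (Real.sign p.N)) := by
  have h : TiltedVI0.InInterior γ p := ⟨hp, hΩ, hN, hV⟩
  refine ⟨TiltedVI0.exists_isSolution hγ hγ' h, ?_⟩
  rintro X hX rfl
  exact hX.tendsto_collins hγ hγ' h
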